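/- Let $F$ be a field containing $\mathbb{C}$, let $n\ge 0$, and let $k,m$ be coprime positive integers. Let $\mathbb{H}$ be the rational Cherednik algebra of $G(1,1,n)=S_n$ over $F$ with parameters $\kappa=1$ and $c_0=k/m$: the $F$-algebra generated by $x_1,\dots,x_n$, $y_1,\dots,y_n$ and $t_w$ $(w\in S_n)$, where the $x_i$ commute with each other, the $y_i$ commute with each other, $t_{vw}=t_vt_w$, $t_1=1$, $t_wx_i=x_{w(i)}t_w$, $t_wy_i=y_{w(i)}t_w$, and $$y_ix_j=x_jy_i+c_0\,t_{(ij)}\quad(i\ne j),\qquad y_ix_i=x_iy_i+1-c_0\sum_{j\ne i}t_{(ij)} .$$ For a partition $\lambda$ of $n$ let $S^\lambda$ be the irreducible $FS_n$-module indexed by $\lambda$ (with $S^{(n)}$ trivial), let $M(\lambda)$ be the standard module, i.e. the $\mathbb{H}$-module induced from $S^\lambda$, regarded as a module over the subalgebra generated by the $t_w$ and the $y_i$ with every $y_i$ acting by $0$, and let $L(\lambda)$ be the irreducible head of $M(\lambda)$, i.e. its quotient by its unique maximal submodule. Let $\lambda$ and $\mu$ be partitions of $n$. If $L(\mu)$ is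 a composition factor (a simple subquotient) of $M(\lambda)$, then $\mu\le_d\lambda$ in dominance order, i.e. $\mu_1+\dots+\mu_j\le\lambda_1+\dots+\lambda_j$ for all $j$, and $\mu$ and $\lambda$ have the same $m$-core, where the $m$-core of a partition is what remains after removing rim $m$-hooks for as long as possible. -/

import Mathlib

open scoped TensorProduct

noncomputable section

namespace Cherednik

/-! ### The rational Cherednik algebra of the symmetric group -/

/-- Generators: `x i`, `y i` for `i : Fin n`, and `t w` for `w` in the symmetric group. -/
inductive Gen (n : ℕ) : Type
  | x (i : Fin n) : Gen n
  | y (i : Fin n) : Gen n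
  | t (w : Equiv.Perm (Fin n)) : Gen n

section Algebra

variable (F : Type*) [Field F] (n : ℕ) (kappa c₀ : F)

/-- The generator `x i` of the free algebra. -/
abbrev fx (i : Fin n) : FreeAlgebra F (Gen n) := FreeAlgebra.ι F (Gen.x i)

/-- The generator `y i` of the free algebra. -/
abbrev fy (i : Fin n) : FreeAlgebra F (Gen n) := FreeAlgebra.ι F (Gen.y i)

/-- The generator `t w` of the free algebra. -/
abbrev ft (w : Equiv.Perm (Fin n)) : FreeAlgebra F (Gen n) := FreeAlgebra.ι F (Gen.t w)

/-- The defining relations of the rational Cherednik algebra of `G(1,1,n) = S_n` with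
parameters `kappa` and `c₀`. -/
inductive Rel : FreeAlgebra F (Gen n) → FreeAlgebra F (Gen n) → Prop
  | x_comm (i j : Fin n) : Rel (fx F n i * fx F n j) (fx F n j * fx F n i)
  | y_comm (i j : Fin n) : Rel (fy F n i * fy F n j) (fy F n j * fy F n i)
  | t_one : Rel (ft F n 1) 1
  | t_mul (v w : Equiv.Perm (Fin n)) : Rel (ft F n (v * w)) (ft F n v * ft F n w)
  | t_x (w : Equiv.Perm (Fin n)) (i : Fin n) :
      Rel (ft F n w * fx F n i) (fx F n (w i) * ft F n w)
  | t_y (w : Equiv.Perm (Fin n)) (i : Fin n) :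
      Rel (ft F n w * fy F n i) (fy F n (w i) * ft F n w)
  | y_x_ne (i j : Fin n) (h : i ≠ j) :
      Rel (fy F n i * fx F n j) (fx F n j * fy F n i + c₀ • ft F n (Equiv.swap i j))
  | y_x_self (i : Fin n) :
      Rel (fy F n i * fx F n i)
        (fx F n i * fy F n i + algebraMap F (FreeAlgebra F (Gen n)) kappa
          - c₀ • ∑ j ∈ Finset.univ.erase i, ft F n (Equiv.swap i j))

/-- The rational Cherednik algebra of `G(1,1,n) = S_n` with parameters `kappa` and `c₀`. -/
def RCA : Type _ := RingQuot (Rel F n kappa c₀)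

instance : Ring (RCA F n kappa c₀) := inferInstanceAs (Ring (RingQuot (Rel F n kappa c₀)))

instance : Algebra F (RCA F n kappa c₀) :=
  inferInstanceAs (Algebra F (RingQuot (Rel F n kappa c₀)))

/-- The quotient map from the free algebra. -/
def RCA.mk : FreeAlgebra F (Gen n) →ₐ[F] RCA F n kappa c₀ :=
  RingQuot.mkAlgHom F (Rel F n kappa c₀)

/-- The element `y i` of the rational Cherednik algebra. -/
def RCA.y (i : Fin n) : RCA F n kappa c₀ :=
  RCA.mk F n kappa c₀ (fy F n i)

/-- The element `t w` of the rational Cherednik algebra. -/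
def RCA.t (w : Equiv.Perm (Fin n)) : RCA F n kappa c₀ :=
  RCA.mk F n kappa c₀ (ft F n w)

end Algebra

/-! ### The irreducible modules of the symmetric group -/

section Specht

variable (F : Type*) [Field F] {n : ℕ}

/-- The row symmetrizer of a numbering `T` of the boxes of `lam` by `Fin n`: the sum of all
permutations that preserve the rows of `T`.  A box `(i, j)` is in row `i` and column `j`. -/
def rowSymmetrizer {lam : YoungDiagram} (T : Fin n ≃ lam.cells) :
    MonoidAlgebra F (Equiv.Perm (Fin n)) :=
  open Classical in
  ∑ w ∈ Finset.univ.filter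
      (fun w : Equiv.Perm (Fin n) => ∀ p, (T (w p)).1.1 = (T p).1.1),
    MonoidAlgebra.single w 1

/-- The column antisymmetrizer of `T`: the signed sum of all permutations that preserve the
columns of `T`. -/
def columnAntisymmetrizer {lam : YoungDiagram} (T : Fin n ≃ lam.cells) :
    MonoidAlgebra F (Equiv.Perm (Fin n)) :=
  open Classical in
  ∑ w ∈ Finset.univ.filter
      (fun w : Equiv.Perm (Fin n) => ∀ p, (T (w p)).1.2 = (T p).1.2),
    MonoidAlgebra.single w ((Equiv.Perm.sign w : ℤ) : F)

/-- A numbering of the boxes of `lam`.  The module `Specht` below does not depend on the choice,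
up to isomorphism. -/
def numbering (lam : YoungDiagram) (h : lam.card = n) : Fin n ≃ lam.cells :=
  (lam.cells.equivFinOfCardEq h).symm

/-- The irreducible module `S^lam` of the symmetric group over a field of characteristic zero:
the left ideal of the group algebra generated by a Young symmetrizer of shape `lam`.
For a single row this is the trivial module. -/
abbrev Specht (lam : YoungDiagram) (h : lam.card = n) : Type _ :=
  ↥(Ideal.span {rowSymmetrizer F (numbering lam h) * columnAntisymmetrizer F (numbering lam h)} :
    Ideal (MonoidAlgebra F (Equiv.Perm (Fin n))))

end Specht

/-! ### Standard modules and their irreducible heads -/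

section Standard

variable {F : Type*} [Field F] (n : ℕ) (kappa c₀ : F)

/-- The relations `t w ⊗ v = 1 ⊗ w v` and `y i ⊗ v = 0` that cut the induced module
out of the free extension of scalars `H ⊗[F] V`. -/
def inductionRelations (V : Type*) [AddCommGroup V] [Module F V]
    [Module (MonoidAlgebra F (Equiv.Perm (Fin n))) V]
    [IsScalarTower F (MonoidAlgebra F (Equiv.Perm (Fin n))) V] :
    Submodule (RCA F n kappa c₀) (RCA F n kappa c₀ ⊗[F] V) :=
  Submodule.span (RCA F n kappa c₀)
    ({z | ∃ (w : Equiv.Perm (Fin n)) (v : V),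
        z = RCA.t F n kappa c₀ w ⊗ₜ[F] v
          - 1 ⊗ₜ[F] ((MonoidAlgebra.single w 1 : MonoidAlgebra F (Equiv.Perm (Fin n))) • v)} ∪
      {z | ∃ (i : Fin n) (v : V), z = RCA.y F n kappa c₀ i ⊗ₜ[F] v})

/-- The module induced to the rational Cherednik algebra from the `S_n`-module `V`, on which
all `y i` are made to act by zero. -/
abbrev Induced (V : Type*) [AddCommGroup V] [Module F V]
    [Module (MonoidAlgebra F (Equiv.Perm (Fin n))) V]
    [IsScalarTower F (MonoidAlgebra F (Equiv.Perm (Fin n))) V] : Type _ :=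
  (RCA F n kappa c₀ ⊗[F] V) ⧸ inductionRelations n kappa c₀ V

/-- The standard (Verma) module `M(lam)`. -/
abbrev StandardModule (lam : YoungDiagram) (h : lam.card = n) : Type _ :=
  Induced n kappa c₀ (Specht F lam h)

/-- The module `L(lam)`: the head of `M(lam)`, that is, the quotient of `M(lam)` by the
intersection of its maximal submodules (for `kappa = 1` in characteristic zero there is
exactly one maximal submodule). -/
abbrev SimpleHead (lam : YoungDiagram) (h : lam.card = n) : Type _ :=
  StandardModule n kappa c₀ lam h ⧸
    Module.jacobson (RCA F n kappa c₀) (StandardModule n kappa c₀ lam h)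

end Standard

/-- `L` is a composition factor of `M`: it is simple and isomorphic to a subquotient of `M`. -/
def IsCompositionFactor (R L M : Type*) [Ring R] [AddCommGroup L] [Module R L]
    [AddCommGroup M] [Module R M] : Prop :=
  IsSimpleModule R L ∧
    ∃ N P : Submodule R M, N ≤ P ∧ Nonempty ((↥P ⧸ N.submoduleOf P) ≃ₗ[R] L)

/-! ### Dominance order and cores -/

/-- Dominance order `mu ≤_d lam` (for diagrams with equally many boxes). -/
def DominanceLE (mu lam : YoungDiagram) : Prop :=
  mu.card = lam.card ∧
    ∀ j : ℕ, ∑ i ∈ Finset.range j, mu.rowLen i ≤ ∑ i ∈ Finset.range j, lam.rowLen i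

/-- Two boxes share an edge. -/
def Adjacent (a b : ℕ × ℕ) : Prop :=
  (a.1 = b.1 ∧ (a.2 + 1 = b.2 ∨ b.2 + 1 = a.2)) ∨
    (a.2 = b.2 ∧ (a.1 + 1 = b.1 ∨ b.1 + 1 = a.1))

/-- `nu` is obtained from `lam` by removing a rim `m`-hook: a nonempty edge-connected set of `m`
boxes of the rim of `lam`, where a box `(i, j)` is in the rim if `(i + 1, j + 1)` is not in
`lam`. -/
structure RemovesRimHook (m : ℕ) (lam nu : YoungDiagram) : Prop where
  le : nu ≤ lam
  nonempty : (lam.cells \ nu.cells).Nonempty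
  card_eq : (lam.cells \ nu.cells).card = m
  rim : ∀ a ∈ lam.cells \ nu.cells, (a.1 + 1, a.2 + 1) ∉ lam.cells
  connected : ∀ a ∈ lam.cells \ nu.cells, ∀ b ∈ lam.cells \ nu.cells,
    Relation.ReflTransGen (fun c d => d ∈ lam.cells \ nu.cells ∧ Adjacent c d) a b

/-- `kap` is reached from `lam` by successively removing rim `m`-hooks, and has none itself. -/
def IsCoreOf (m : ℕ) (kap lam : YoungDiagram) : Prop :=
  Relation.ReflTransGen (RemovesRimHook m) lam kap ∧ ∀ nu, ¬ RemovesRimHook m kap nu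

theorem exists_isCoreOf (m : ℕ) (lam : YoungDiagram) : ∃ kap, IsCoreOf m kap lam := by
  induction hN : lam.card using Nat.strong_induction_on generalizing lam with
  | _ N ih =>
    by_cases h : ∃ nu, RemovesRimHook m lam nu
    · obtain ⟨nu, hnu⟩ := h
      have hlt : nu.card < N := by
        rw [← hN]
        apply Finset.card_lt_card
        refine ⟨hnu.le, fun hs => ?_⟩
        obtain ⟨a, ha⟩ := hnu.nonempty
        rw [Finset.mem_sdiff] at ha
        exact ha.2 (hs ha.1)
      obtain ⟨kap, h1, h2⟩ := ih nu.card hlt nu rfl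
      exact ⟨kap, Relation.ReflTransGen.head hnu h1, h2⟩
    · exact ⟨lam, Relation.ReflTransGen.refl, fun nu hnu => h ⟨nu, hnu⟩⟩

/-- The `m`-core of a partition: the partition that remains after rim `m`-hooks have been
removed for as long as possible (it does not depend on the order of removal). -/
def core (m : ℕ) (lam : YoungDiagram) : YoungDiagram :=
  Classical.choose (exists_isCoreOf m lam)

end Cherednik

end

namespace Cherednik

open MvPolynomial

/-! ### Polynomials in commuting elements of an algebra -/

section Evaluation

variable {F R : Type*} [Field F] [Ring R] [Algebra F R] {n : ℕ}

/-! The proof reads off the joint spectrum of commuting elements. Let `J_i` be the Jucys-Murphy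
elements and put `z_i = x_i y_i + 1 - c₀ J_i`. The `z_i` commute, and with the adjacent
transpositions they satisfy the relations of a degenerate affine Hecke algebra, so symmetric
polynomials in them commute with every `t_w`. On the generators of `M(λ)` the `y_i` vanish, and a
symmetric `f(z)` acts by the scalar `f` evaluated at the numbers `1 - c₀ ct(b)`, where `b` runs over
the boxes of `λ` and `ct` is the content (`exists_symmetric_smul_specht`).

With indices starting at `0` and `π` the long cycle, `Φ = x_0 t_π` satisfies `z_{i+1} Φ = Φ z_i` and
`z_0 Φ = Φ (z_last + 1)`, and every `x_i` has the form `t_v Φ t_w`. Hence raising the degree in the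
`x_i` by one adds `1` to one entry of the spectrum, and on all of `M(λ)` only the spectra `1 + a_b -
c₀ ct(b)` with natural numbers `a_b` occur, up to order. If `L(μ)` is a subquotient, the spectrum of
its generators is among these. This yields a bijection `e` from the boxes of `μ` to those of `λ`
with `c₀ (ct(e b) - ct(b))` natural for every `b` (`exists_equiv_content_of_isCompositionFactor`).

For `c₀ = k/m` with `k` and `m` coprime, the differences `ct(e b) - ct(b)` are nonnegative and
divisible by `m`. Nonnegativity gives dominance (`dominanceLE_of_equiv`). Divisibility says that `λ`
and `μ` have equally many boxes of each residue, which determines the `m`-core through the abacus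
(`core_eq_of_equiv`).

No eigenvectors are used: a point `χ` is excluded from the spectrum of a vector by a symmetric `f`
with `f(χ) ≠ 0` whose `f(z)` kills the vector. For this it is enough that the homogeneous layers
span `M(λ)`; their independence plays no role. -/

open scoped IsMulCommutative in
theorem exists_algHom_of_commute (z : Fin n → R) (hz : ∀ i j, Commute (z i) (z j)) :
    ∃ φ : MvPolynomial (Fin n) F →ₐ[F] R, ∀ i, φ (X i) = z i := by
  have hc : ∀ a ∈ Set.range z, ∀ b ∈ Set.range z, a * b = b * a := by
    rintro _ ⟨i, rfl⟩ _ ⟨j, rfl⟩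
    exact hz i j
  have := Algebra.isMulCommutative_adjoin F hc
  refine ⟨(Algebra.adjoin F (Set.range z)).val.comp
    (aeval (S₁ := Algebra.adjoin F (Set.range z))
      fun i => ⟨z i, Algebra.subset_adjoin ⟨i, rfl⟩⟩), fun i => ?_⟩
  simp

/-- If `s` satisfies the relations of a degenerate affine Hecke algebra with the commuting elements
`φ (X l)`, then it satisfies the Demazure relation with their polynomials. -/
theorem exists_mul_algHom_eq (φ : MvPolynomial (Fin n) F →ₐ[F] R) (s : R) (p q : Fin n) (c : F)
    (hp : s * φ (X p) = φ (X q) * s + algebraMap F R c)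
    (hq : s * φ (X q) = φ (X p) * s - algebraMap F R c)
    (hl : ∀ l, l ≠ p → l ≠ q → s * φ (X l) = φ (X l) * s) (f : MvPolynomial (Fin n) F) :
    ∃ g : MvPolynomial (Fin n) F, (X p - X q) * g = f - rename (Equiv.swap p q) f ∧
      s * φ f = φ (rename (Equiv.swap p q) f) * s + c • φ g := by
  classical
  induction f using MvPolynomial.induction_on with
  | C a =>
    refine ⟨0, by simp, ?_⟩
    simp only [map_zero, smul_zero, add_zero, ← algebraMap_eq, AlgHom.commutes]
    exact (Algebra.commutes a s).symm
  | add f₁ f₂ h₁ h₂ =>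
    obtain ⟨g₁, e₁, k₁⟩ := h₁
    obtain ⟨g₂, e₂, k₂⟩ := h₂
    refine ⟨g₁ + g₂, by rw [mul_add, e₁, e₂, map_add]; ring, ?_⟩
    rw [map_add, mul_add, k₁, k₂, map_add, map_add, map_add, add_mul, smul_add]
    abel
  | mul_X f j h =>
    obtain ⟨g, e, k⟩ := h
    have key : ∃ ε : F, s * φ (X j) = φ (X (Equiv.swap p q j)) * s + algebraMap F R (c * ε) ∧
        C ε * (X p - X q) = (X j - X (Equiv.swap p q j) : MvPolynomial (Fin n) F) := by
      by_cases h₁ : j = p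
      · subst h₁
        exact ⟨1, by simpa using hp, by simp⟩
      by_cases h₂ : j = q
      · subst h₂
        exact ⟨-1, by simp [hq, sub_eq_add_neg], by simp⟩
      · exact ⟨0, by simp [Equiv.swap_apply_of_ne_of_ne h₁ h₂, hl j h₁ h₂],
          by simp [Equiv.swap_apply_of_ne_of_ne h₁ h₂]⟩
    obtain ⟨ε, hε, hε'⟩ := key
    refine ⟨rename (Equiv.swap p q) f * C ε + g * X j, ?_, ?_⟩
    · rw [map_mul, rename_X]
      linear_combination (X j : MvPolynomial (Fin n) F) * e +
        rename (Equiv.swap p q) f * hε'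
    · have hC : φ (C ε) = algebraMap F R ε := by rw [← algebraMap_eq, AlgHom.commutes]
      rw [map_mul, ← mul_assoc, k, add_mul, mul_assoc, hε, map_mul, map_mul, rename_X, map_add,
        map_mul, map_mul, hC, mul_add, mul_assoc, smul_add, smul_mul_assoc, map_mul,
        ← Algebra.smul_def, add_assoc, mul_smul_comm]

/-- For symmetric `f` the Demazure relation gives `(X p - X q) * g = 0` in a domain, so the error
term vanishes. -/
theorem commute_algHom_of_isSymmetric (φ : MvPolynomial (Fin n) F →ₐ[F] R) (s : R) (p q : Fin n)
    (hpq : p ≠ q) (c : F)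
    (hp : s * φ (X p) = φ (X q) * s + algebraMap F R c)
    (hq : s * φ (X q) = φ (X p) * s - algebraMap F R c)
    (hl : ∀ l, l ≠ p → l ≠ q → s * φ (X l) = φ (X l) * s) {f : MvPolynomial (Fin n) F}
    (hf : f.IsSymmetric) : Commute s (φ f) := by
  obtain ⟨g, e, k⟩ := exists_mul_algHom_eq φ s p q c hp hq hl f
  rw [hf (Equiv.swap p q)] at e k
  rw [sub_self, mul_eq_zero, sub_eq_zero] at e
  have hg : g = 0 := e.resolve_left fun h => hpq (X_injective h)
  simpa [hg, Commute, SemiconjBy] using k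

theorem algHom_mul_eq_of_intertwine (φ : MvPolynomial (Fin n) F →ₐ[F] R) (P : R)
    (ψ : MvPolynomial (Fin n) F →ₐ[F] MvPolynomial (Fin n) F)
    (h : ∀ i, φ (X i) * P = P * φ (ψ (X i))) (f : MvPolynomial (Fin n) F) :
    φ f * P = P * φ (ψ f) := by
  induction f using MvPolynomial.induction_on with
  | C a =>
    simp only [← algebraMap_eq, AlgHom.commutes]
    exact Algebra.commutes a P
  | add f₁ f₂ h₁ h₂ => rw [map_add, add_mul, h₁, h₂, map_add, map_add, mul_add]
  | mul_X f j e => rw [map_mul, mul_assoc, h, ← mul_assoc, e, mul_assoc, map_mul, map_mul]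

theorem exists_eq_aeval_esymm (f : MvPolynomial (Fin n) F) (hf : f.IsSymmetric) :
    ∃ q : MvPolynomial (Fin n) F, f = aeval (fun i : Fin n => esymm (Fin n) F (i + 1)) q := by
  obtain ⟨q, hq⟩ := esymmAlgHom_surjective (σ := Fin n) (n := n) F (by simp) ⟨f, hf⟩
  refine ⟨q, ?_⟩
  have := congrArg Subtype.val hq
  rw [← esymmAlgHom_apply, this]

/-- The hypothesis determines the coefficients of the monic polynomial with roots `χ i`, hence the
multiset of values; equal fibre sizes then give the permutation. -/
theorem map_univ_eq_of_esymm_eq (χ χ' : Fin n → F)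
    (h : ∀ r, eval χ (esymm (Fin n) F r) = eval χ' (esymm (Fin n) F r)) :
    ∃ σ : Equiv.Perm (Fin n), χ = χ' ∘ σ := by
  classical
  have hm : (Finset.univ.val.map χ) = (Finset.univ.val.map χ') := by
    have hr : ∀ r, (Finset.univ.val.map χ).esymm r = (Finset.univ.val.map χ').esymm r := by
      intro r
      rw [← aeval_esymm_eq_multiset_esymm (Fin n) F r χ,
        ← aeval_esymm_eq_multiset_esymm (Fin n) F r χ']
      simpa [aeval_eq_eval] using h r
    have hp : ((Finset.univ.val.map χ).map fun t => Polynomial.X - Polynomial.C t).prod =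
        ((Finset.univ.val.map χ').map fun t => Polynomial.X - Polynomial.C t).prod := by
      rw [Multiset.prod_X_sub_X_eq_sum_esymm, Multiset.prod_X_sub_X_eq_sum_esymm]
      simp only [hr, Multiset.card_map]
    have := congrArg Polynomial.roots hp
    rwa [Polynomial.roots_multiset_prod_X_sub_C, Polynomial.roots_multiset_prod_X_sub_C] at this
  have hc : ∀ a : F, Fintype.card {i // χ i = a} = Fintype.card {i // χ' i = a} := by
    intro a
    have := congrArg (Multiset.count a) hm
    rw [Multiset.count_map, Multiset.count_map] at this
    rw [Fintype.card_subtype, Fintype.card_subtype]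
    simpa [Finset.card, eq_comm] using this
  refine ⟨Equiv.ofFiberEquiv fun a => Fintype.equivOfCardEq (hc a), ?_⟩
  funext i
  exact (Equiv.ofFiberEquiv_map _ i).symm

end Evaluation

/-! ### Jucys-Murphy elements and Young symmetrizers -/

section GroupAlgebra

variable (F : Type*) [Field F] {n : ℕ}

/-- The Jucys-Murphy element: the sum of the transpositions `(i k)` with `i < k`. -/
noncomputable def jucysMurphy (k : Fin n) : MonoidAlgebra F (Equiv.Perm (Fin n)) :=
  ∑ i ∈ Finset.Iio k, MonoidAlgebra.of F _ (Equiv.swap i k)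

variable {F}

theorem of_mul_jucysMurphy (w : Equiv.Perm (Fin n)) (k : Fin n) :
    MonoidAlgebra.of F _ w * jucysMurphy F k =
      (∑ i ∈ Finset.Iio k, MonoidAlgebra.of F _ (Equiv.swap (w i) (w k))) *
        MonoidAlgebra.of F _ w := by
  rw [jucysMurphy, Finset.mul_sum, Finset.sum_mul]
  refine Finset.sum_congr rfl fun i _ => ?_
  rw [← map_mul, ← map_mul, Equiv.mul_swap_eq_swap_mul]

/-- Conjugation by `w` permutes the summands `(i k)`. -/
theorem commute_of_jucysMurphy {w : Equiv.Perm (Fin n)} {k : Fin n} (hk : w k = k)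
    (h : ∀ i, i < k ↔ w i < k) : Commute (MonoidAlgebra.of F _ w) (jucysMurphy F k) := by
  rw [Commute, SemiconjBy, of_mul_jucysMurphy, hk]
  congr 1
  exact Finset.sum_equiv w (by simpa using h) fun _ _ => rfl

theorem commute_jucysMurphy (k l : Fin n) :
    Commute (jucysMurphy F k) (jucysMurphy F l) := by
  have key : ∀ k l : Fin n, k < l → Commute (jucysMurphy F k) (jucysMurphy F l) := by
    intro k l hkl
    refine Commute.sum_left _ _ _ fun i hi => ?_
    rw [Finset.mem_Iio] at hi
    refine commute_of_jucysMurphy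
      (Equiv.swap_apply_of_ne_of_ne (hi.trans hkl).ne' hkl.ne') fun j => ?_
    rw [Equiv.swap_apply_def]
    have := hi.trans hkl
    split_ifs <;> simp_all
  rcases lt_trichotomy k l with h | h | h
  · exact key k l h
  · subst h; exact Commute.refl _
  · exact (key l k h).symm

section Adjacent

variable {p q : Fin n} (hpq : p.val + 1 = q.val)

include hpq

/-- Conjugating `J_p` by `(p q)` gives `J_q` without its summand `(p q)`; that summand accounts for
the `1`. -/
theorem of_swap_mul_jucysMurphy_left :
    MonoidAlgebra.of F _ (Equiv.swap p q) * jucysMurphy F p =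
      jucysMurphy F q * MonoidAlgebra.of F _ (Equiv.swap p q) - 1 := by
  have hlt : p < q := by rw [Fin.lt_def]; omega
  have hI : Finset.Iio q = insert p (Finset.Iio p) := by
    ext i
    simp only [Finset.mem_Iio, Finset.mem_insert, Fin.lt_def, Fin.ext_iff]
    omega
  rw [of_mul_jucysMurphy, jucysMurphy, hI, Finset.sum_insert (by simp), add_mul, ← map_mul,
    Equiv.swap_mul_self, map_one, add_sub_cancel_left, Equiv.swap_apply_left]
  congr 1
  refine Finset.sum_congr rfl fun i hi => ?_
  rw [Finset.mem_Iio] at hi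
  rw [Equiv.swap_apply_of_ne_of_ne hi.ne (hi.trans hlt).ne]

theorem of_swap_mul_jucysMurphy_right :
    MonoidAlgebra.of F _ (Equiv.swap p q) * jucysMurphy F q =
      jucysMurphy F p * MonoidAlgebra.of F _ (Equiv.swap p q) + 1 := by
  have hs : MonoidAlgebra.of F _ (Equiv.swap p q) * MonoidAlgebra.of F _ (Equiv.swap p q) = 1 := by
    rw [← map_mul, Equiv.swap_mul_self, map_one]
  have h := congrArg (fun a => MonoidAlgebra.of F _ (Equiv.swap p q) * a *
    MonoidAlgebra.of F _ (Equiv.swap p q)) (of_swap_mul_jucysMurphy_left (F := F) hpq)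
  simp only [mul_sub, sub_mul, ← mul_assoc, hs, one_mul, mul_one] at h
  rw [mul_assoc _ _ (MonoidAlgebra.of F _ (Equiv.swap p q)), hs, mul_one] at h
  rw [h, sub_add_cancel]

theorem of_swap_mul_jucysMurphy_of_ne {l : Fin n} (hp : l ≠ p) (hq : l ≠ q) :
    MonoidAlgebra.of F _ (Equiv.swap p q) * jucysMurphy F l =
      jucysMurphy F l * MonoidAlgebra.of F _ (Equiv.swap p q) := by
  refine commute_of_jucysMurphy (Equiv.swap_apply_of_ne_of_ne hp hq) fun j => ?_
  rw [Equiv.swap_apply_def]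
  split_ifs with h₁ h₂ <;> simp only [Fin.lt_def, ne_eq, Fin.ext_iff] at * <;> omega

end Adjacent

/-- An element that commutes with all adjacent transpositions commutes with all permutations. -/
theorem commute_of_adjacent {R : Type*} [Monoid R] (θ : Equiv.Perm (Fin n) →* R) (a : R)
    (h : ∀ p q : Fin n, p.val + 1 = q.val → Commute (θ (Equiv.swap p q)) a)
    (w : Equiv.Perm (Fin n)) : Commute (θ w) a := by
  cases n with
  | zero => rw [Subsingleton.elim w 1, map_one]; exact Commute.one_left a
  | succ n =>
    have hw : w ∈ Submonoid.closure
        (Set.range fun i : Fin n => Equiv.swap i.castSucc i.succ) := by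
      rw [Equiv.Perm.mclosure_swap_castSucc_succ]; trivial
    induction hw using Submonoid.closure_induction with
    | mem x hx => obtain ⟨i, rfl⟩ := hx; exact h _ _ (by simp)
    | one => rw [map_one]; exact Commute.one_left a
    | mul x y _ _ hx hy => rw [map_mul]; exact hx.mul_left hy

/-- The permutations that preserve the fibres of `r` and fix all `j ≥ k`. -/
def fiberGroup (r : Fin n → ℕ) (k : ℕ) : Subgroup (Equiv.Perm (Fin n)) where
  carrier := {w | (∀ p, r (w p) = r p) ∧ ∀ j : Fin n, k ≤ j → w j = j}
  one_mem' := by simp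
  mul_mem' := by
    rintro v w ⟨hv, hv'⟩ ⟨hw, hw'⟩
    refine ⟨fun p => by simp [hv, hw], fun j hj => by simp [hw' j hj, hv' j hj]⟩
  inv_mem' := by
    rintro w ⟨hw, hw'⟩
    refine ⟨fun p => by rw [← hw, ← Equiv.Perm.mul_apply, mul_inv_cancel, Equiv.Perm.one_apply],
      fun j hj => by rw [Equiv.Perm.inv_eq_iff_eq, hw' j hj]⟩

theorem mem_fiberGroup {r : Fin n → ℕ} {k : ℕ} {w : Equiv.Perm (Fin n)} :
    w ∈ fiberGroup r k ↔ (∀ p, r (w p) = r p) ∧ ∀ j : Fin n, k ≤ j → w j = j := Iff.rfl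

theorem fiberGroup_mono (r : Fin n → ℕ) {k l : ℕ} (h : k ≤ l) :
    fiberGroup r k ≤ fiberGroup r l :=
  fun _ hw => ⟨hw.1, fun j hj => hw.2 j (h.trans hj)⟩

theorem swap_mem_fiberGroup {r : Fin n → ℕ} {k : ℕ} {i j : Fin n} (h : r i = r j)
    (hi : i.val < k) (hj : j.val < k) : Equiv.swap i j ∈ fiberGroup r k := by
  refine ⟨fun p => ?_, fun p hp => Equiv.swap_apply_of_ne_of_ne ?_ ?_⟩
  · rw [Equiv.swap_apply_def]
    split_ifs with h₁ h₂ <;> simp_all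
  · rintro rfl; omega
  · rintro rfl; omega

open Classical in
/-- The sum of the elements of a group `G` of permutations, weighted by a character `ε`. -/
noncomputable def weightedSum (F : Type*) [Field F] (ε : Equiv.Perm (Fin n) →* ℤˣ)
    (G : Subgroup (Equiv.Perm (Fin n))) : MonoidAlgebra F (Equiv.Perm (Fin n)) :=
  ∑ w ∈ Finset.univ.filter (· ∈ G), MonoidAlgebra.single w ((ε w : ℤ) : F)

variable {ε : Equiv.Perm (Fin n) →* ℤˣ} {G H : Subgroup (Equiv.Perm (Fin n))}

theorem units_int_cast_mul_self (u : ℤˣ) : ((u : ℤ) : F) * ((u : ℤ) : F) = 1 := by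
  rw [← Int.cast_mul, ← Units.val_mul, Int.units_mul_self]; simp

theorem of_mul_weightedSum {g : Equiv.Perm (Fin n)} (hg : g ∈ G) :
    MonoidAlgebra.of F _ g * weightedSum F ε G = ((ε g : ℤ) : F) • weightedSum F ε G := by
  classical
  rw [weightedSum, Finset.mul_sum, Finset.smul_sum]
  refine Finset.sum_equiv (Equiv.mulLeft g) (fun w => ?_) fun w _ => ?_
  · simp [Subgroup.mul_mem_cancel_left G hg]
  · rw [Equiv.coe_mulLeft, MonoidAlgebra.of_apply, MonoidAlgebra.single_mul_single, one_mul,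
      MonoidAlgebra.smul_single, map_mul, smul_eq_mul, Units.val_mul, Int.cast_mul, ← mul_assoc,
      units_int_cast_mul_self, one_mul]

theorem weightedSum_mul_of {g : Equiv.Perm (Fin n)} (hg : g ∈ G) :
    weightedSum F ε G * MonoidAlgebra.of F _ g = ((ε g : ℤ) : F) • weightedSum F ε G := by
  classical
  rw [weightedSum, Finset.sum_mul, Finset.smul_sum]
  refine Finset.sum_equiv (Equiv.mulRight g) (fun w => ?_) fun w _ => ?_
  · simp [Subgroup.mul_mem_cancel_right G hg]
  · rw [Equiv.coe_mulRight, MonoidAlgebra.of_apply, MonoidAlgebra.single_mul_single, mul_one,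
      MonoidAlgebra.smul_single, map_mul, smul_eq_mul, Units.val_mul, Int.cast_mul, mul_comm,
      mul_assoc, units_int_cast_mul_self, mul_one]

theorem single_units_eq (w : Equiv.Perm (Fin n)) (a : F) :
    (MonoidAlgebra.single w a : MonoidAlgebra F (Equiv.Perm (Fin n))) =
      a • MonoidAlgebra.of F _ w := by
  rw [MonoidAlgebra.of_apply, MonoidAlgebra.smul_single, smul_eq_mul, mul_one]

/-- `N` is the order of `H`: each `w ∈ H` carries the weight `ε w` and acts on the larger sum by `ε
w`. In this way a small symmetrizer can be split off a larger one and absorbed again. -/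
theorem exists_weightedSum_mul_weightedSum [CharZero F] (h : H ≤ G) :
    ∃ N : F, N ≠ 0 ∧ weightedSum F ε H * weightedSum F ε G = N • weightedSum F ε G ∧
      weightedSum F ε G * weightedSum F ε H = N • weightedSum F ε G := by
  classical
  refine ⟨((Finset.univ.filter (· ∈ H)).card : F), ?_, ?_, ?_⟩
  · rw [Nat.cast_ne_zero, Finset.card_ne_zero]
    exact ⟨1, by simp [H.one_mem]⟩
  · conv_lhs => enter [1]; rw [weightedSum]
    rw [Finset.sum_mul, Finset.sum_congr rfl fun w hw => ?_, Finset.sum_const,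
      Nat.cast_smul_eq_nsmul]
    rw [single_units_eq, smul_mul_assoc, of_mul_weightedSum (h (Finset.mem_filter.1 hw).2),
      smul_smul, units_int_cast_mul_self, one_smul]
  · conv_lhs => enter [2]; rw [weightedSum]
    rw [Finset.mul_sum, Finset.sum_congr rfl fun w hw => ?_, Finset.sum_const,
      Nat.cast_smul_eq_nsmul]
    rw [single_units_eq, mul_smul_comm, weightedSum_mul_of (h (Finset.mem_filter.1 hw).2),
      smul_smul, units_int_cast_mul_self, one_smul]

theorem commute_weightedSum {a : MonoidAlgebra F (Equiv.Perm (Fin n))}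
    (h : ∀ g ∈ G, Commute (MonoidAlgebra.of F _ g) a) : Commute (weightedSum F ε G) a := by
  classical
  refine Commute.sum_left _ _ _ fun w hw => ?_
  rw [single_units_eq]
  exact (h w (Finset.mem_filter.1 hw).2).smul_left _

/-- Serves to pass from an arbitrary numbering of a diagram to a standard one. -/
theorem of_mul_weightedSum_conj {r r' : Fin n → ℕ} (π : Equiv.Perm (Fin n))
    (h : ∀ i, r (π i) = r' i) :
    MonoidAlgebra.of F _ π * weightedSum F ε (fiberGroup r' n) =
      weightedSum F ε (fiberGroup r n) * MonoidAlgebra.of F _ π := by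
  classical
  rw [weightedSum, weightedSum, Finset.mul_sum, Finset.sum_mul]
  refine Finset.sum_equiv (MulAut.conj π).toEquiv (fun w => ?_) fun w _ => ?_
  · simp only [Finset.mem_filter, Finset.mem_univ, true_and, mem_fiberGroup,
      MulEquiv.toEquiv_eq_coe, EquivLike.coe_coe, MulAut.conj_apply, Equiv.Perm.mul_apply, h]
    refine and_congr ⟨fun hw p => ?_, fun hw p => ?_⟩ ?_
    · rw [hw, ← h, ← Equiv.Perm.mul_apply, mul_inv_cancel, Equiv.Perm.one_apply]
    · have := hw (π p)
      simpa [h] using this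
    · constructor <;> intro _ j hj <;> omega
  · simp only [MulEquiv.toEquiv_eq_coe, EquivLike.coe_coe, MulAut.conj_apply]
    rw [MonoidAlgebra.of_apply, MonoidAlgebra.single_mul_single, MonoidAlgebra.single_mul_single]
    congr 1
    · group
    · rw [map_mul, map_mul, map_inv, mul_comm (ε π), mul_inv_cancel_right, one_mul, mul_one]

/-- Young's vanishing lemma: the symmetrizers on both sides of `w` kill it if some transposition is
in the group on the left and its conjugate is in the group on the right. -/
theorem weightedSum_mul_of_mul_weightedSum_eq_zero [CharZero F] {w : Equiv.Perm (Fin n)}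
    {a b : Fin n} (hab : a ≠ b) (hG : Equiv.swap a b ∈ G)
    (hH : Equiv.swap (w.symm a) (w.symm b) ∈ H) :
    weightedSum F 1 G * MonoidAlgebra.of F _ w * weightedSum F Equiv.Perm.sign H = 0 := by
  have hne : w.symm a ≠ w.symm b := fun h => hab (w.symm.injective h)
  have h₁ := weightedSum_mul_of (F := F) (ε := 1) hG
  have h₂ := of_mul_weightedSum (F := F) (ε := Equiv.Perm.sign) hH
  have h₃ : Equiv.swap a b * w = w * Equiv.swap (w.symm a) (w.symm b) := by
    rw [Equiv.mul_swap_eq_swap_mul]; simp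
  rw [Equiv.Perm.sign_swap hne] at h₂
  simp only [MonoidHom.one_apply, Units.val_one, Int.cast_one, one_smul, Units.val_neg,
    Int.cast_neg, neg_smul] at h₁ h₂
  have := calc
    weightedSum F 1 G * MonoidAlgebra.of F _ w * weightedSum F Equiv.Perm.sign H
      = weightedSum F 1 G * MonoidAlgebra.of F _ (Equiv.swap a b) * MonoidAlgebra.of F _ w *
          weightedSum F Equiv.Perm.sign H := by rw [h₁]
    _ = weightedSum F 1 G * MonoidAlgebra.of F _ w *
          (MonoidAlgebra.of F _ (Equiv.swap (w.symm a) (w.symm b)) *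
            weightedSum F Equiv.Perm.sign H) := by
        rw [mul_assoc (weightedSum F 1 G), ← map_mul, h₃, map_mul]; simp only [mul_assoc]
    _ = -(weightedSum F 1 G * MonoidAlgebra.of F _ w * weightedSum F Equiv.Perm.sign H) := by
        rw [h₂, mul_neg]
  have h₄ := eq_neg_iff_add_eq_zero.1 this
  rw [← two_smul F] at h₄
  exact (smul_eq_zero.1 h₄).resolve_left two_ne_zero

end GroupAlgebra

/-! ### Symmetric polynomials in Jucys-Murphy elements act on Specht modules by contents -/

section Contents

variable {F : Type*} [Field F] {n : ℕ}

/-- `r` and `c` are the row and column indices of the entries of a standard tableau. -/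
structure IsStandardPair (r c : Fin n → ℕ) : Prop where
  row_card : ∀ k, ((Finset.Iio k).filter fun i => r i = r k).card = c k
  col_card : ∀ k, ((Finset.Iio k).filter fun i => c i = c k).card = r k
  inj : ∀ i k, r i = r k → c i = c k → i = k
  corner : ∀ i k, i < k → r i ≠ r k → c i ≠ c k →
    ∃ j < k, (r j = r i ∧ c j = c k) ∨ (r j = r k ∧ c j = c i)

variable {r c : Fin n → ℕ}

/-- A summand `(i k)` is absorbed with sign `+1` by the row symmetrizer if `i` is in the row of `k`,
and with sign `-1` by the column antisymmetrizer if `i` is in its column. Otherwise a third corner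
`j` of the rectangle spanned by `i` and `k` is occupied, and Young's lemma makes the term vanish.
Counting the signs gives the content of `k`. -/
theorem IsStandardPair.weightedSum_mul_jucysMurphy [CharZero F] (h : IsStandardPair r c)
    (k : Fin n) :
    weightedSum F 1 (fiberGroup r (k + 1)) * jucysMurphy F k *
        weightedSum F Equiv.Perm.sign (fiberGroup c (k + 1)) =
      ((c k : F) - r k) • (weightedSum F 1 (fiberGroup r (k + 1)) *
        weightedSum F Equiv.Perm.sign (fiberGroup c (k + 1))) := by
  set a := weightedSum F 1 (fiberGroup r (k + 1))
  set b := weightedSum F Equiv.Perm.sign (fiberGroup c (k + 1))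
  have hterm : ∀ i ∈ Finset.Iio k, a * MonoidAlgebra.of F _ (Equiv.swap i k) * b =
      ((if r i = r k then (1 : F) else 0) - if c i = c k then 1 else 0) • (a * b) := by
    intro i hi
    rw [Finset.mem_Iio] at hi
    have hik : i.val < k.val + 1 := by rw [Fin.lt_def] at hi; omega
    by_cases hr : r i = r k
    · have hc : c i ≠ c k := fun hc => hi.ne (h.inj i k hr hc)
      rw [weightedSum_mul_of (swap_mem_fiberGroup hr hik (Nat.lt_succ_self _))]
      simp [hr, hc, a]
    by_cases hc : c i = c k
    · rw [mul_assoc, of_mul_weightedSum (swap_mem_fiberGroup hc hik (Nat.lt_succ_self _)),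
        Equiv.Perm.sign_swap hi.ne]
      simp [hr, hc, b]
    · rw [if_neg hr, if_neg hc, sub_zero, zero_smul]
      obtain ⟨j, hj, hj'⟩ := h.corner i k hi hr hc
      have hjk : j.val < k.val + 1 := by rw [Fin.lt_def] at hj; omega
      rcases hj' with ⟨h₁, h₂⟩ | ⟨h₁, h₂⟩
      · have hij : i ≠ j := by rintro rfl; exact hc h₂
        refine weightedSum_mul_of_mul_weightedSum_eq_zero hij
          (swap_mem_fiberGroup h₁.symm hik hjk) ?_
        rw [Equiv.symm_swap, Equiv.swap_apply_left, Equiv.swap_apply_of_ne_of_ne hij.symm hj.ne]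
        exact swap_mem_fiberGroup h₂.symm (Nat.lt_succ_self _) hjk
      · have hij : i ≠ j := by rintro rfl; exact hr h₁
        refine weightedSum_mul_of_mul_weightedSum_eq_zero hj.ne
          (swap_mem_fiberGroup h₁ hjk (Nat.lt_succ_self _)) ?_
        rw [Equiv.symm_swap, Equiv.swap_apply_right, Equiv.swap_apply_of_ne_of_ne hij.symm hj.ne]
        exact swap_mem_fiberGroup h₂ hjk hik
  rw [jucysMurphy, Finset.mul_sum, Finset.sum_mul, Finset.sum_congr rfl hterm, ← Finset.sum_smul,
    Finset.sum_sub_distrib, Finset.sum_boole, Finset.sum_boole, h.row_card, h.col_card]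

/-- Only squarefree monomials are treated, so each entry contributes its content once, and the
largest entry can be peeled off by induction on `k`. -/
theorem IsStandardPair.weightedSum_mul_prod [CharZero F] (h : IsStandardPair r c) {α β : F}
    (φ : MvPolynomial (Fin n) F →ₐ[F] MonoidAlgebra F (Equiv.Perm (Fin n)))
    (hφ : ∀ i, φ (X i) = algebraMap F _ α + β • jucysMurphy F i) (k : ℕ) (s : Finset (Fin n))
    (hs : ∀ i ∈ s, i.val < k) :
    weightedSum F 1 (fiberGroup r k) * φ (∏ i ∈ s, X i) *
        weightedSum F Equiv.Perm.sign (fiberGroup c k) =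
      (∏ i ∈ s, (α + β * ((c i : F) - r i))) • (weightedSum F 1 (fiberGroup r k) *
        weightedSum F Equiv.Perm.sign (fiberGroup c k)) := by
  classical
  induction k generalizing s with
  | zero =>
    have : s = ∅ := Finset.eq_empty_of_forall_notMem fun i hi => by simpa using hs i hi
    simp [this]
  | succ k ih =>
    set a := weightedSum F 1 (fiberGroup r k)
    set b := weightedSum F Equiv.Perm.sign (fiberGroup c k)
    set a' := weightedSum F 1 (fiberGroup r (k + 1))
    set b' := weightedSum F Equiv.Perm.sign (fiberGroup c (k + 1))
    obtain ⟨N, hN, -, hN'⟩ := exists_weightedSum_mul_weightedSum (F := F) (ε := 1)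
      (fiberGroup_mono r k.le_succ)
    obtain ⟨N', hN₁, hN₁', -⟩ := exists_weightedSum_mul_weightedSum (F := F)
      (ε := Equiv.Perm.sign) (fiberGroup_mono c k.le_succ)
    -- Up to `N * N'`, write `a'` as `a' * a` and `b'` as `b * b'`. Since `B` commutes with `b`, the
    -- factor `A` stands between `a` and `b`, where the induction hypothesis turns it into a scalar.
    have hlift : ∀ (A B : MonoidAlgebra F (Equiv.Perm (Fin n))) (p : F),
        a * A * b = p • (a * b) → Commute b B → a' * (A * B) * b' = p • (a' * B * b') := by
      intro A B p hA hB
      have h₁ : (N * N') • (a' * (A * B) * b') = (N * N') • (p • (a' * B * b')) := calc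
        (N * N') • (a' * (A * B) * b') = (N • a') * (A * B) * (N' • b') := by
          simp only [smul_mul_assoc, mul_smul_comm, smul_smul]; rw [mul_comm]
        _ = a' * (a * A * (B * b)) * b' := by rw [← hN', ← hN₁']; simp only [mul_assoc, a, a', b, b']
        _ = p • (a' * a * B * (b * b')) := by
          rw [← hB.eq, ← mul_assoc (a * A), hA]
          simp only [smul_mul_assoc, mul_smul_comm, mul_assoc]
          rw [← mul_assoc b B, hB.eq, mul_assoc]
        _ = (N * N') • (p • (a' * B * b')) := by
          simp only [a, a', b, b'] at *
          rw [hN', hN₁']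
          simp only [smul_mul_assoc, mul_smul_comm, smul_smul]
          congr 1; ring
      exact smul_right_injective _ (mul_ne_zero hN hN₁) h₁
    by_cases hk : ∃ i ∈ s, i.val = k
    · obtain ⟨i, hi, rfl⟩ := hk
      have hs' : ∀ j ∈ s.erase i, j.val < i.val := by
        intro j hj
        rw [Finset.mem_erase] at hj
        have h₁ := hs j hj.2
        have h₂ : j.val ≠ i.val := fun e => hj.1 (Fin.ext e)
        omega
      have hB : Commute b (φ (X i)) := by
        rw [hφ]
        refine commute_weightedSum fun g hg => ?_
        refine (Algebra.commute_algebraMap_right _ _).add_right (Commute.smul_right ?_ _)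
        have hgi : g i = i := hg.2 i le_rfl
        refine commute_of_jucysMurphy hgi fun j => ?_
        rw [← not_le, ← not_le, not_iff_not]
        constructor
        · intro hj; rwa [hg.2 j hj]
        · intro hj
          have := hg.2 (g j) hj
          rwa [g.injective this] at hj
      have := hlift _ _ _ (ih (s.erase i) hs') hB
      rw [← map_mul, Finset.prod_erase_mul _ _ hi] at this
      rw [this, hφ, mul_add, add_mul, mul_smul_comm, smul_mul_assoc,
        h.weightedSum_mul_jucysMurphy i, ← Finset.prod_erase_mul _ _ hi, mul_smul,
        ← Algebra.commutes, ← Algebra.smul_def, smul_mul_assoc, smul_smul β, ← add_smul]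
    · have hs' : ∀ j ∈ s, j.val < k := by
        intro j hj
        have h₁ := hs j hj
        have h₂ : j.val ≠ k := fun e => hk ⟨j, hj, e⟩
        omega
      simpa using hlift _ 1 _ (ih s hs') (Commute.one_right b)

theorem commute_of_isSymmetric_jucysMurphy {α β : F}
    (φ : MvPolynomial (Fin n) F →ₐ[F] MonoidAlgebra F (Equiv.Perm (Fin n)))
    (hφ : ∀ i, φ (X i) = algebraMap F _ α + β • jucysMurphy F i) {f : MvPolynomial (Fin n) F}
    (hf : f.IsSymmetric) (a : MonoidAlgebra F (Equiv.Perm (Fin n))) : Commute a (φ f) := by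
  have hof : ∀ w, Commute (MonoidAlgebra.of F _ w) (φ f) := by
    refine commute_of_adjacent _ _ fun p q hpq => ?_
    have hne : p ≠ q := by rintro rfl; omega
    refine commute_algHom_of_isSymmetric φ _ p q hne (-β) ?_ ?_ ?_ hf
    · rw [hφ, hφ, mul_add, mul_smul_comm, of_swap_mul_jucysMurphy_left hpq, ← Algebra.commutes,
        add_mul, smul_sub, smul_mul_assoc, map_neg, Algebra.algebraMap_eq_smul_one β]
      abel
    · rw [hφ, hφ, mul_add, mul_smul_comm, of_swap_mul_jucysMurphy_right hpq, ← Algebra.commutes,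
        add_mul, smul_add, smul_mul_assoc, map_neg, Algebra.algebraMap_eq_smul_one β]
      abel
    · intro l hlp hlq
      rw [hφ, mul_add, mul_smul_comm, of_swap_mul_jucysMurphy_of_ne hpq hlp hlq,
        ← Algebra.commutes, add_mul, smul_mul_assoc]
  induction a using MonoidAlgebra.induction_on with
  | of w => exact hof w
  | add a b ha hb => exact ha.add_left hb
  | smul t a ha => exact ha.smul_left t

/-- `φ f` is central, so it may be moved between the two symmetrizers. There an elementary symmetric
polynomial is a sum of squarefree monomials, and these polynomials generate all symmetric ones. -/
theorem IsStandardPair.algHom_mul_weightedSum [CharZero F] (h : IsStandardPair r c) {α β : F}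
    (φ : MvPolynomial (Fin n) F →ₐ[F] MonoidAlgebra F (Equiv.Perm (Fin n)))
    (hφ : ∀ i, φ (X i) = algebraMap F _ α + β • jucysMurphy F i) {f : MvPolynomial (Fin n) F}
    (hf : f.IsSymmetric) :
    φ f * (weightedSum F 1 (fiberGroup r n) *
        weightedSum F Equiv.Perm.sign (fiberGroup c n)) =
      eval (fun i => α + β * ((c i : F) - r i)) f • (weightedSum F 1 (fiberGroup r n) *
        weightedSum F Equiv.Perm.sign (fiberGroup c n)) := by
  have hesymm : ∀ d, φ (esymm (Fin n) F d) * (weightedSum F 1 (fiberGroup r n) *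
        weightedSum F Equiv.Perm.sign (fiberGroup c n)) =
      eval (fun i => α + β * ((c i : F) - r i)) (esymm (Fin n) F d) •
        (weightedSum F 1 (fiberGroup r n) *
        weightedSum F Equiv.Perm.sign (fiberGroup c n)) := by
    intro d
    rw [← mul_assoc, ← (commute_of_isSymmetric_jucysMurphy φ hφ
      (esymm_isSymmetric (Fin n) F d) _).eq, esymm, map_sum, map_sum, Finset.mul_sum,
      Finset.sum_mul, Finset.sum_smul]
    refine Finset.sum_congr rfl fun s _ => ?_
    rw [h.weightedSum_mul_prod φ hφ n s fun i _ => i.isLt, map_prod]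
    simp only [eval_X]
  obtain ⟨q, rfl⟩ := exists_eq_aeval_esymm f hf
  clear hf
  induction q using MvPolynomial.induction_on with
  | C t => simp [← algebraMap_eq, Algebra.smul_def]
  | add f g hf hg => rw [map_add, map_add, map_add, add_mul, add_smul, hf, hg]
  | mul_X f i hf =>
    rw [map_mul, map_mul, map_mul, mul_assoc, aeval_X, hesymm, mul_smul_comm, hf, smul_smul,
      mul_comm]

end Contents

section SpechtModule

variable {F : Type*} [Field F] {n : ℕ} {lam : YoungDiagram}

/-- A numbering that increases along the product order gives the indices of a standard tableau. -/
theorem isStandardPair_of_monotone (T : Fin n ≃ lam.cells)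
    (hT : ∀ i j, (T i).1 ≤ (T j).1 → i ≤ j) :
    IsStandardPair (fun i => (T i).1.1) (fun i => (T i).1.2) := by
  have hinj : ∀ i k, (T i).1.1 = (T k).1.1 → (T i).1.2 = (T k).1.2 → i = k := fun i k h₁ h₂ =>
    T.injective (Subtype.ext (Prod.ext h₁ h₂))
  have hex : ∀ (k : Fin n) (b : ℕ × ℕ), b ≤ (T k).1 → b ≠ (T k).1 → ∃ j < k, (T j).1 = b := by
    intro k b hb hb'
    have hmem : b ∈ lam.cells := lam.isLowerSet hb (T k).2
    refine ⟨T.symm ⟨b, hmem⟩, lt_of_le_of_ne (hT _ _ (by simpa using hb)) ?_, by simp⟩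
    rintro rfl
    simp at hb'
  have hlt : ∀ i k, i < k → ¬ (T k).1 ≤ (T i).1 := fun i k h h' => h.not_ge (hT _ _ h')
  refine ⟨fun k => ?_, fun k => ?_, hinj, fun i k hik hr hc => ?_⟩
  · rw [← Finset.card_range (T k).1.2]
    refine Finset.card_bij (fun i _ => (T i).1.2) ?_ ?_ ?_
    · intro i hi
      simp only [Finset.mem_filter, Finset.mem_Iio] at hi
      rw [Finset.mem_range]
      by_contra hcon
      exact hlt i k hi.1 (Prod.mk_le_mk.2 ⟨hi.2.ge, not_lt.1 hcon⟩)
    · intro i hi j hj hij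
      simp only [Finset.mem_filter, Finset.mem_Iio] at hi hj
      exact hinj i j (hi.2.trans hj.2.symm) hij
    · intro d hd
      rw [Finset.mem_range] at hd
      obtain ⟨j, hj, hj'⟩ := hex k ((T k).1.1, d) ⟨le_rfl, hd.le⟩
        fun e => hd.ne (congrArg Prod.snd e)
      exact ⟨j, by simp [hj, hj'], by simp [hj']⟩
  · rw [← Finset.card_range (T k).1.1]
    refine Finset.card_bij (fun i _ => (T i).1.1) ?_ ?_ ?_
    · intro i hi
      simp only [Finset.mem_filter, Finset.mem_Iio] at hi
      rw [Finset.mem_range]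
      by_contra hcon
      exact hlt i k hi.1 (Prod.mk_le_mk.2 ⟨not_lt.1 hcon, hi.2.ge⟩)
    · intro i hi j hj hij
      simp only [Finset.mem_filter, Finset.mem_Iio] at hi hj
      exact hinj i j hij (hi.2.trans hj.2.symm)
    · intro d hd
      rw [Finset.mem_range] at hd
      obtain ⟨j, hj, hj'⟩ := hex k (d, (T k).1.2) ⟨hd.le, le_rfl⟩
        fun e => hd.ne (congrArg Prod.fst e)
      exact ⟨j, by simp [hj, hj'], by simp [hj']⟩
  · rcases lt_or_gt_of_ne hr with h | h
    · obtain ⟨j, hj, hj'⟩ := hex k ((T i).1.1, (T k).1.2) ⟨h.le, le_rfl⟩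
        fun e => hr (by simpa using congrArg Prod.fst e)
      exact ⟨j, hj, Or.inl (by simp [hj'])⟩
    · have h' : (T i).1.2 < (T k).1.2 := by
        by_contra hcon
        exact hlt i k hik (Prod.mk_le_mk.2 ⟨h.le, not_lt.1 hcon⟩)
      obtain ⟨j, hj, hj'⟩ := hex k ((T k).1.1, (T i).1.2) ⟨le_rfl, h'.le⟩
        fun e => hc (by simpa using congrArg Prod.snd e)
      exact ⟨j, hj, Or.inr (by simp [hj'])⟩

/-- Enumerate the boxes along a linear extension of the product order. -/
theorem exists_standard_numbering (h : lam.card = n) :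
    ∃ T : Fin n ≃ lam.cells, ∀ i j, (T i).1 ≤ (T j).1 → i ≤ j := by
  let _ : Fintype (LinearExtension lam.cells) := inferInstanceAs (Fintype lam.cells)
  have hcard : Fintype.card (LinearExtension lam.cells) = n := by
    rw [← h]; exact Fintype.card_coe lam.cells
  let e := monoEquivOfFin (LinearExtension lam.cells) hcard
  refine ⟨e.toEquiv, fun i j hij => ?_⟩
  have : toLinearExtension (α := lam.cells) (e i) ≤ toLinearExtension (α := lam.cells) (e j) :=
    (toLinearExtension (α := lam.cells)).monotone hij
  exact e.le_iff_le.1 this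

theorem rowSymmetrizer_eq (T : Fin n ≃ lam.cells) :
    rowSymmetrizer F T = weightedSum F 1 (fiberGroup (fun i => (T i).1.1) n) := by
  classical
  unfold rowSymmetrizer weightedSum
  refine Finset.sum_congr ?_ fun w _ => by simp
  ext w
  simp only [Finset.mem_filter, Finset.mem_univ, true_and, mem_fiberGroup, iff_self_and]
  intro _ j hj; omega

theorem columnAntisymmetrizer_eq (T : Fin n ≃ lam.cells) :
    columnAntisymmetrizer F T =
      weightedSum F Equiv.Perm.sign (fiberGroup (fun i => (T i).1.2) n) := by
  classical
  unfold columnAntisymmetrizer weightedSum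
  refine Finset.sum_congr ?_ fun w _ => rfl
  ext w
  simp only [Finset.mem_filter, Finset.mem_univ, true_and, mem_fiberGroup, iff_self_and]
  intro _ j hj; omega

/-- The Young symmetrizer of the chosen numbering is conjugate by `π` to that of a standard one, and
`φ f` is central. `T` does not depend on `α`, `β` or `φ`. -/
theorem exists_symmetric_smul_specht [CharZero F] (h : lam.card = n) :
    ∃ T : Fin n ≃ lam.cells, ∀ (α β : F)
      (φ : MvPolynomial (Fin n) F →ₐ[F] MonoidAlgebra F (Equiv.Perm (Fin n))),
      (∀ i, φ (X i) = algebraMap F _ α + β • jucysMurphy F i) →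
      ∀ f : MvPolynomial (Fin n) F, f.IsSymmetric → ∀ v : Specht F lam h,
        φ f • v = eval (fun i => α + β * (((T i).1.2 : F) - (T i).1.1)) f • v := by
  obtain ⟨T, hT⟩ := exists_standard_numbering h
  refine ⟨T, fun α β φ hφ f hf v => ?_⟩
  obtain ⟨v, hv⟩ := v
  obtain ⟨x, rfl⟩ := Ideal.mem_span_singleton'.1 hv
  apply Subtype.ext
  change φ f * (x * _) = _ • (x * _)
  set T' := numbering lam h
  set π : Equiv.Perm (Fin n) := T'.trans T.symm
  have hπ : ∀ i, T (π i) = T' i := fun i => by simp [π]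
  have hr := of_mul_weightedSum_conj (F := F) (ε := 1) (r := fun i => (T i).1.1)
    (r' := fun i => (T' i).1.1) π fun i => by rw [hπ]
  have hc := of_mul_weightedSum_conj (F := F) (ε := Equiv.Perm.sign) (r := fun i => (T i).1.2)
    (r' := fun i => (T' i).1.2) π fun i => by rw [hπ]
  have hcomm := commute_of_isSymmetric_jucysMurphy φ hφ hf
  have hkey := (isStandardPair_of_monotone T hT).algHom_mul_weightedSum φ hφ hf
  have hinv : MonoidAlgebra.of F _ π⁻¹ * MonoidAlgebra.of F _ π = 1 := by
    rw [← map_mul, inv_mul_cancel, map_one]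
  rw [rowSymmetrizer_eq, columnAntisymmetrizer_eq]
  set a := weightedSum F 1 (fiberGroup (fun i => (T i).1.1) n)
  set b := weightedSum F Equiv.Perm.sign (fiberGroup (fun i => (T i).1.2) n)
  set a' := weightedSum F 1 (fiberGroup (fun i => (T' i).1.1) n)
  set b' := weightedSum F Equiv.Perm.sign (fiberGroup (fun i => (T' i).1.2) n)
  have hab : a' * b' = MonoidAlgebra.of F _ π⁻¹ * (a * b) * MonoidAlgebra.of F _ π := calc
    a' * b' = MonoidAlgebra.of F _ π⁻¹ * (MonoidAlgebra.of F _ π * a') * b' := by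
      rw [← mul_assoc, hinv, one_mul]
    _ = _ := by rw [hr]; simp only [mul_assoc]; rw [hc]
  rw [hab, ← mul_assoc, ← (hcomm x).eq, mul_assoc, ← mul_assoc (φ f), ← mul_assoc (φ f),
    ← (hcomm _).eq, mul_assoc (MonoidAlgebra.of F _ π⁻¹), hkey]
  simp only [mul_smul_comm, smul_mul_assoc]

end SpechtModule

/-! ### Commuting elements and an intertwiner in the rational Cherednik algebra -/

section Relations

variable {F : Type*} [Field F] {n : ℕ} {kappa c₀ : F}

variable (F n kappa c₀) in
/-- The element `x i` of the rational Cherednik algebra. -/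
noncomputable def RCA.x (i : Fin n) : RCA F n kappa c₀ := RCA.mk F n kappa c₀ (fx F n i)

theorem RCA.mk_eq_of_rel {a b : FreeAlgebra F (Gen n)} (h : Rel F n kappa c₀ a b) :
    RCA.mk F n kappa c₀ a = RCA.mk F n kappa c₀ b :=
  RingQuot.mkAlgHom_rel F h

local notation "x" => RCA.x F n kappa c₀
local notation "y" => RCA.y F n kappa c₀
local notation "t" => RCA.t F n kappa c₀

theorem RCA.x_mul_x (i j : Fin n) : x i * x j = x j * x i := by
  have := RCA.mk_eq_of_rel (Rel.x_comm (kappa := kappa) (c₀ := c₀) i j)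
  simp only [map_mul] at this
  exact this

theorem RCA.y_mul_y (i j : Fin n) : y i * y j = y j * y i := by
  have := RCA.mk_eq_of_rel (Rel.y_comm (kappa := kappa) (c₀ := c₀) i j)
  simp only [map_mul] at this
  exact this

theorem RCA.t_one : t 1 = 1 := by
  have := RCA.mk_eq_of_rel (Rel.t_one (F := F) (n := n) (kappa := kappa) (c₀ := c₀))
  simp only [map_one] at this
  exact this

theorem RCA.t_mul (v w : Equiv.Perm (Fin n)) : t (v * w) = t v * t w := by
  have := RCA.mk_eq_of_rel (Rel.t_mul (F := F) (kappa := kappa) (c₀ := c₀) v w)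
  simp only [map_mul] at this
  exact this

theorem RCA.t_mul_x (w : Equiv.Perm (Fin n)) (i : Fin n) : t w * x i = x (w i) * t w := by
  have := RCA.mk_eq_of_rel (Rel.t_x (F := F) (kappa := kappa) (c₀ := c₀) w i)
  simp only [map_mul] at this
  exact this

theorem RCA.t_mul_y (w : Equiv.Perm (Fin n)) (i : Fin n) : t w * y i = y (w i) * t w := by
  have := RCA.mk_eq_of_rel (Rel.t_y (F := F) (kappa := kappa) (c₀ := c₀) w i)
  simp only [map_mul] at this
  exact this

theorem RCA.y_mul_x_of_ne {i j : Fin n} (h : i ≠ j) :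
    y i * x j = x j * y i + c₀ • t (Equiv.swap i j) := by
  have := RCA.mk_eq_of_rel (Rel.y_x_ne (F := F) (kappa := kappa) (c₀ := c₀) i j h)
  simp only [map_mul, map_add, map_smul] at this
  exact this

theorem RCA.y_mul_x_self (i : Fin n) :
    y i * x i = x i * y i + algebraMap F _ kappa
      - c₀ • ∑ j ∈ Finset.univ.erase i, t (Equiv.swap i j) := by
  have := RCA.mk_eq_of_rel (Rel.y_x_self (F := F) (kappa := kappa) (c₀ := c₀) i)
  simp only [map_mul, map_add, map_sub, map_smul, map_sum, AlgHom.commutes] at this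
  exact this

variable (F n kappa c₀) in
/-- The homomorphism from the group algebra of the symmetric group. -/
noncomputable def RCA.ofGroupAlgebra :
    MonoidAlgebra F (Equiv.Perm (Fin n)) →ₐ[F] RCA F n kappa c₀ :=
  MonoidAlgebra.lift F (RCA F n kappa c₀) (Equiv.Perm (Fin n))
    { toFun := t, map_one' := RCA.t_one, map_mul' := RCA.t_mul }

local notation "θ" => RCA.ofGroupAlgebra F n kappa c₀

theorem RCA.ofGroupAlgebra_of (w : Equiv.Perm (Fin n)) : θ (MonoidAlgebra.of F _ w) = t w :=
  MonoidAlgebra.lift_of _ _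

theorem RCA.ofGroupAlgebra_jucysMurphy (k : Fin n) :
    θ (jucysMurphy F k) = ∑ i ∈ Finset.Iio k, t (Equiv.swap i k) := by
  rw [jucysMurphy, map_sum]
  exact Finset.sum_congr rfl fun i _ => RCA.ofGroupAlgebra_of _

variable (F n kappa c₀) in
/-- The commuting elements of Dunkl, Opdam and Cherednik. -/
noncomputable def RCA.z (i : Fin n) : RCA F n kappa c₀ :=
  x i * y i + algebraMap F _ kappa - c₀ • θ (jucysMurphy F i)

local notation "z" => RCA.z F n kappa c₀

theorem RCA.t_mul_xy (w : Equiv.Perm (Fin n)) (i : Fin n) :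
    t w * (x i * y i) = x (w i) * y (w i) * t w := by
  rw [← mul_assoc, RCA.t_mul_x, mul_assoc, RCA.t_mul_y, mul_assoc]

theorem RCA.xy_mul_xy {i j : Fin n} (h : i ≠ j) :
    x i * y i * (x j * y j) = x i * x j * (y i * y j) +
      c₀ • (x i * y i * t (Equiv.swap i j)) := by
  rw [mul_assoc (x i), ← mul_assoc (y i), RCA.y_mul_x_of_ne h, add_mul, smul_mul_assoc,
    RCA.t_mul_y, Equiv.swap_apply_right, mul_add, mul_smul_comm]
  simp only [mul_assoc]

/-- Of the transpositions in `J_j`, only `(i j)` moves `i`. -/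
theorem RCA.xy_mul_jucysMurphy {i j : Fin n} (h : i < j) :
    x i * y i * θ (jucysMurphy F j) - θ (jucysMurphy F j) * (x i * y i) =
      x i * y i * t (Equiv.swap i j) - x j * y j * t (Equiv.swap i j) := by
  rw [RCA.ofGroupAlgebra_jucysMurphy, Finset.mul_sum, Finset.sum_mul, ← Finset.sum_sub_distrib,
    Finset.sum_eq_single_of_mem i (Finset.mem_Iio.2 h), RCA.t_mul_xy, Equiv.swap_apply_left]
  intro l _ hl
  rw [RCA.t_mul_xy, Equiv.swap_apply_of_ne_of_ne hl.symm h.ne, sub_self]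

theorem RCA.xy_mul_jucysMurphy_of_lt {i j : Fin n} (h : i < j) :
    θ (jucysMurphy F i) * (x j * y j) = x j * y j * θ (jucysMurphy F i) := by
  rw [RCA.ofGroupAlgebra_jucysMurphy, Finset.mul_sum, Finset.sum_mul]
  refine Finset.sum_congr rfl fun l hl => ?_
  rw [Finset.mem_Iio] at hl
  rw [RCA.t_mul_xy, Equiv.swap_apply_of_ne_of_ne (hl.trans h).ne' h.ne']

/-- For `i < j`, the commutator of `x i * y i` and `x j * y j` equals `c₀` times that of `x i * y i`
and `J_j`, so the two cancel; the remaining commutators vanish. -/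
theorem RCA.commute_z (i j : Fin n) : Commute (z i) (z j) := by
  have key : ∀ i j : Fin n, i < j → Commute (z i) (z j) := by
    intro i j hij
    have h₁ := RCA.xy_mul_xy (kappa := kappa) (c₀ := c₀) hij.ne
    have h₂ := RCA.xy_mul_xy (kappa := kappa) (c₀ := c₀) hij.ne'
    have h₃ := RCA.xy_mul_jucysMurphy (kappa := kappa) (c₀ := c₀) hij
    have h₄ := RCA.xy_mul_jucysMurphy_of_lt (kappa := kappa) (c₀ := c₀) hij
    have h₅ : θ (jucysMurphy F i) * θ (jucysMurphy F j) =
        θ (jucysMurphy F j) * θ (jucysMurphy F i) := by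
      rw [← map_mul, (commute_jucysMurphy i j).eq, map_mul]
    rw [RCA.x_mul_x j i, RCA.y_mul_y j i, Equiv.swap_comm j i] at h₂
    have h₆ : Commute (x i * y i - c₀ • θ (jucysMurphy F i))
        (x j * y j - c₀ • θ (jucysMurphy F j)) := by
      rw [Commute, SemiconjBy, sub_mul, sub_mul, mul_sub, mul_sub, mul_sub, mul_sub, h₁, h₂]
      simp only [smul_mul_assoc, mul_smul_comm]
      rw [h₄, h₅, sub_eq_iff_eq_add.1 h₃, smul_add, smul_sub]
      abel
    have e : ∀ l, z l = (x l * y l - c₀ • θ (jucysMurphy F l)) + algebraMap F _ kappa := by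
      intro l; rw [RCA.z]; abel
    rw [e, e]
    exact (h₆.add_left (Algebra.commute_algebraMap_left _ _)).add_right
      (Algebra.commute_algebraMap_right _ _)
  rcases lt_trichotomy i j with h | h | h
  · exact key i j h
  · subst h; exact Commute.refl _
  · exact (key j i h).symm

theorem RCA.t_mul_z (w : Equiv.Perm (Fin n)) (i : Fin n) :
    t w * z i = (x (w i) * y (w i) + algebraMap F _ kappa) * t w -
      c₀ • θ (MonoidAlgebra.of F _ w * jucysMurphy F i) := by
  rw [RCA.z, mul_sub, mul_add, RCA.t_mul_xy, ← Algebra.commutes, mul_smul_comm, map_mul,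
    RCA.ofGroupAlgebra_of, add_mul]

theorem RCA.commute_t_of_isSymmetric (φ : MvPolynomial (Fin n) F →ₐ[F] RCA F n kappa c₀)
    (hφ : ∀ i, φ (X i) = z i) {f : MvPolynomial (Fin n) F} (hf : f.IsSymmetric)
    (w : Equiv.Perm (Fin n)) : Commute (t w) (φ f) := by
  refine commute_of_adjacent ⟨⟨t, RCA.t_one⟩, RCA.t_mul⟩ _ (fun p q hpq => ?_) w
  have hne : p ≠ q := by rintro rfl; omega
  refine commute_algHom_of_isSymmetric φ _ p q hne c₀ ?_ ?_ ?_ hf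
  · change t _ * _ = _ * t _ + _
    rw [hφ, hφ, RCA.t_mul_z, of_swap_mul_jucysMurphy_left hpq, RCA.z, Equiv.swap_apply_left,
      map_sub, map_mul, RCA.ofGroupAlgebra_of, sub_mul, smul_sub, map_one, smul_mul_assoc,
      Algebra.algebraMap_eq_smul_one c₀]
    abel
  · change t _ * _ = _ * t _ - _
    rw [hφ, hφ, RCA.t_mul_z, of_swap_mul_jucysMurphy_right hpq, RCA.z, Equiv.swap_apply_right,
      map_add, map_mul, RCA.ofGroupAlgebra_of, sub_mul, smul_add, map_one, smul_mul_assoc,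
      Algebra.algebraMap_eq_smul_one c₀]
    abel
  · intro l hlp hlq
    change t _ * _ = _ * t _
    rw [hφ, RCA.t_mul_z, of_swap_mul_jucysMurphy_of_ne hpq hlp hlq, RCA.z,
      Equiv.swap_apply_of_ne_of_ne hlp hlq, map_mul, RCA.ofGroupAlgebra_of, sub_mul,
      smul_mul_assoc]

end Relations

section Intertwiner

variable {F : Type*} [Field F] {n : ℕ} {kappa c₀ : F}

local notation "x" => RCA.x F (n + 1) kappa c₀
local notation "y" => RCA.y F (n + 1) kappa c₀
local notation "t" => RCA.t F (n + 1) kappa c₀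
local notation "z" => RCA.z F (n + 1) kappa c₀
local notation "θ" => RCA.ofGroupAlgebra F (n + 1) kappa c₀

theorem RCA.t_mul_z_eq_mul_t (w : Equiv.Perm (Fin (n + 1))) (i : Fin (n + 1)) :
    t w * z i = (x (w i) * y (w i) + algebraMap F _ kappa -
      c₀ • ∑ l ∈ Finset.Iio i, t (Equiv.swap (w l) (w i))) * t w := by
  rw [RCA.t_mul_z, of_mul_jucysMurphy, map_mul, RCA.ofGroupAlgebra_of, map_sum, sub_mul,
    smul_mul_assoc]
  simp only [RCA.ofGroupAlgebra_of]

/-- Rotation carries the summands of `J_i` to those of `J_{i+1}` except `(0 i+1)`. The contribution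
of this last one cancels against the term produced by moving `y i.succ` past `x 0`. -/
theorem RCA.z_succ_mul_intertwiner (i : Fin n) :
    z i.succ * (x 0 * t (finRotate (n + 1))) = x 0 * t (finRotate (n + 1)) * z i.castSucc := by
  have hπ : finRotate (n + 1) i.castSucc = i.succ := by simp
  have hI : Finset.Iio i.succ =
      insert 0 ((Finset.Iio i.castSucc).image (finRotate (n + 1))) := by
    ext j
    simp only [Finset.mem_Iio, Finset.mem_insert, Finset.mem_image]
    refine Fin.cases (by simp) (fun j => ?_) j
    simp only [Fin.succ_lt_succ_iff, Fin.succ_ne_zero, false_or]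
    constructor
    · intro h
      exact ⟨j.castSucc, by simpa using h, by simp⟩
    · rintro ⟨l, hl, hl'⟩
      have : l = j.castSucc := (finRotate (n + 1)).injective (by rw [hl']; simp)
      subst this
      simpa using hl
  have h0 : (0 : Fin (n + 1)) ∉ (Finset.Iio i.castSucc).image (finRotate (n + 1)) := by
    simp only [Finset.mem_image, Finset.mem_Iio, not_exists, not_and]
    intro l hl h
    have : l = Fin.last n := (finRotate (n + 1)).injective (by rw [h]; simp)
    subst this
    exact (Fin.le_last _).not_gt hl
  have hsum : ∀ l ∈ Finset.Iio i.castSucc,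
      t (Equiv.swap (finRotate (n + 1) l) i.succ) * x 0 =
        x 0 * t (Equiv.swap (finRotate (n + 1) l) i.succ) := by
    intro l hl
    rw [RCA.t_mul_x, Equiv.swap_apply_of_ne_of_ne _ (Fin.succ_ne_zero i).symm]
    intro h
    exact h0 (Finset.mem_image.2 ⟨l, hl, h.symm⟩)
  rw [mul_assoc (x 0), RCA.t_mul_z_eq_mul_t, hπ, ← mul_assoc, ← mul_assoc]
  congr 1
  rw [RCA.z, RCA.ofGroupAlgebra_jucysMurphy, hI, Finset.sum_insert h0,
    Finset.sum_image fun a _ b _ h => (finRotate (n + 1)).injective h, sub_mul, mul_sub, add_mul,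
    mul_add, mul_assoc (x i.succ), RCA.y_mul_x_of_ne (Fin.succ_ne_zero i), mul_add, smul_mul_assoc,
    add_mul, RCA.t_mul_x, Equiv.swap_apply_left, Finset.sum_mul, Finset.sum_congr rfl hsum,
    ← Finset.mul_sum, ← mul_assoc, RCA.x_mul_x _ 0, smul_add, mul_smul_comm, mul_smul_comm,
    Equiv.swap_comm 0, Algebra.commutes, mul_assoc]
  abel

/-- `J_0` is zero, and moving `y 0` past `x 0` produces all the transpositions `(0 j)`, which are
the rotated summands of `J_last`, together with one extra `kappa`. -/
theorem RCA.z_zero_mul_intertwiner :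
    z 0 * (x 0 * t (finRotate (n + 1))) =
      x 0 * t (finRotate (n + 1)) * (z (Fin.last n) + algebraMap F _ kappa) := by
  have hπ : finRotate (n + 1) (Fin.last n) = 0 := by simp
  have hsum : ∑ l ∈ Finset.Iio (Fin.last n), t (Equiv.swap (finRotate (n + 1) l) 0) =
      ∑ j ∈ Finset.univ.erase 0, t (Equiv.swap 0 j) := by
    refine Finset.sum_equiv (finRotate (n + 1)) (fun l => ?_) fun l _ => by rw [Equiv.swap_comm]
    rw [Finset.mem_Iio, Finset.mem_erase, ← hπ, Ne, EmbeddingLike.apply_eq_iff_eq]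
    simp [Fin.lt_last_iff_ne_last]
  rw [mul_add (x 0 * _), mul_assoc (x 0), RCA.t_mul_z_eq_mul_t, hπ, hsum, ← Algebra.commutes, ← mul_assoc,
    ← mul_assoc, ← mul_assoc (algebraMap F _ kappa), ← add_mul]
  congr 1
  have hJ : θ (jucysMurphy F 0) = 0 := by
    rw [RCA.ofGroupAlgebra_jucysMurphy]
    exact Finset.sum_eq_zero fun l hl => absurd (Finset.mem_Iio.1 hl) (Fin.not_lt_zero l)
  rw [RCA.z, hJ, smul_zero, sub_zero, add_mul, mul_assoc, RCA.y_mul_x_self]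

end Intertwiner

/-! ### The spectrum of the commuting elements on induced modules -/

section PolynomialAvoidance

variable {F : Type*} [Field F] {n : ℕ}

/-- Prime avoidance: the kernels of evaluations are prime ideals. -/
theorem exists_forall_eval_ne_zero {ι : Type*} [Fintype ι] (I : Ideal (MvPolynomial (Fin n) F))
    (χ : ι → Fin n → F) (h : ∀ i, ∃ f ∈ I, eval (χ i) f ≠ 0) :
    ∃ f ∈ I, ∀ i, eval (χ i) f ≠ 0 := by
  classical
  by_contra! hcon
  cases isEmpty_or_nonempty ι with
  | inl _ =>
    obtain ⟨i, -⟩ := hcon 0 I.zero_mem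
    exact isEmptyElim i
  | inr hne =>
    obtain ⟨i₀⟩ := hne
    have hsub : (I : Set (MvPolynomial (Fin n) F)) ⊆
        ⋃ i ∈ ((Finset.univ : Finset ι) : Set ι), RingHom.ker (eval (χ i)) := by
      intro f hf
      obtain ⟨i, hi⟩ := hcon f hf
      simp only [Set.mem_iUnion]
      exact ⟨i, by simp, hi⟩
    obtain ⟨i, -, hi⟩ := (Ideal.subset_union_prime i₀ i₀ fun i _ _ _ =>
      RingHom.ker_isPrime (eval (χ i))).1 hsub
    obtain ⟨f, hf, hf'⟩ := h i
    exact hf' (hi hf)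

theorem isSymmetric_prod_rename (f : MvPolynomial (Fin n) F) :
    (∏ σ : Equiv.Perm (Fin n), rename σ f).IsSymmetric := by
  intro τ
  rw [map_prod]
  refine Fintype.prod_equiv (Equiv.mulLeft τ) _ _ fun σ => ?_
  rw [rename_rename]
  rfl

end PolynomialAvoidance

/-! ### Generators and layers of an induced module -/

section Induced

variable {F : Type*} [Field F] {n : ℕ} {kappa c₀ : F}
  {V : Type*} [AddCommGroup V] [Module F V] [Module (MonoidAlgebra F (Equiv.Perm (Fin n))) V]
  [IsScalarTower F (MonoidAlgebra F (Equiv.Perm (Fin n))) V]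

variable (n kappa c₀ V) in
/-- The inclusion of `V` into the induced module. -/
noncomputable def Induced.gen : V →+ Induced n kappa c₀ V :=
  (Submodule.mkQ (inductionRelations n kappa c₀ V)).toAddMonoidHom.comp
    (TensorProduct.mk F (RCA F n kappa c₀) V 1).toAddMonoidHom

local notation "gen" => Induced.gen n kappa c₀ V

theorem Induced.gen_apply (v : V) : gen v = Submodule.Quotient.mk (1 ⊗ₜ[F] v) := rfl

theorem Induced.smul_gen (h : RCA F n kappa c₀) (v : V) :
    h • gen v = Submodule.Quotient.mk (h ⊗ₜ[F] v) := by
  rw [Induced.gen_apply, ← Submodule.Quotient.mk_smul, TensorProduct.smul_tmul', smul_eq_mul,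
    mul_one]

theorem Induced.t_smul_gen (w : Equiv.Perm (Fin n)) (v : V) :
    RCA.t F n kappa c₀ w • gen v = gen (MonoidAlgebra.of F (Equiv.Perm (Fin n)) w • v) := by
  rw [Induced.smul_gen, Induced.gen_apply, Submodule.Quotient.eq]
  exact Submodule.subset_span (Or.inl ⟨w, v, rfl⟩)

theorem Induced.y_smul_gen (i : Fin n) (v : V) : RCA.y F n kappa c₀ i • gen v = 0 := by
  rw [Induced.smul_gen, Submodule.Quotient.mk_eq_zero]
  exact Submodule.subset_span (Or.inr ⟨i, v, rfl⟩)

theorem Induced.algebraMap_smul_gen (a : F) (v : V) :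
    algebraMap F (RCA F n kappa c₀) a • gen v = gen (a • v) := by
  rw [Induced.smul_gen, Induced.gen_apply, Algebra.algebraMap_eq_smul_one,
    TensorProduct.smul_tmul]

theorem Induced.ofGroupAlgebra_smul_gen (a : MonoidAlgebra F (Equiv.Perm (Fin n))) (v : V) :
    RCA.ofGroupAlgebra F n kappa c₀ a • gen v = gen (a • v) := by
  induction a using MonoidAlgebra.induction_on with
  | of w => rw [RCA.ofGroupAlgebra_of, Induced.t_smul_gen]
  | add a b ha hb => rw [map_add, add_smul, add_smul, map_add, ha, hb]
  | smul r a ha =>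
    rw [map_smul, Algebra.smul_def, mul_smul, ha, Induced.algebraMap_smul_gen, smul_assoc]

/-- On generators `y i` vanishes, so `z i` acts as `kappa - c₀ J_i`. -/
theorem Induced.algHom_smul_gen (φ : MvPolynomial (Fin n) F →ₐ[F] RCA F n kappa c₀)
    (hφ : ∀ i, φ (X i) = RCA.z F n kappa c₀ i)
    (ψ : MvPolynomial (Fin n) F →ₐ[F] MonoidAlgebra F (Equiv.Perm (Fin n)))
    (hψ : ∀ i, ψ (X i) = algebraMap F _ kappa + (-c₀) • jucysMurphy F i)
    (f : MvPolynomial (Fin n) F) (v : V) : φ f • gen v = gen (ψ f • v) := by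
  induction f using MvPolynomial.induction_on generalizing v with
  | C a =>
    rw [← algebraMap_eq, AlgHom.commutes, AlgHom.commutes, Induced.algebraMap_smul_gen,
      algebraMap_smul]
  | add f g hf hg => rw [map_add, map_add, add_smul, add_smul, map_add, hf, hg]
  | mul_X f i hf =>
    rw [map_mul, map_mul, mul_smul, mul_smul, ← hf, hφ, hψ, RCA.z, sub_smul, add_smul, mul_smul,
      Induced.y_smul_gen, smul_zero, zero_add, Algebra.smul_def, mul_smul,
      Induced.ofGroupAlgebra_smul_gen, Induced.algebraMap_smul_gen, Induced.algebraMap_smul_gen,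
      ← map_sub, add_smul, algebraMap_smul, neg_smul, neg_smul, smul_assoc, sub_eq_add_neg]

variable (n kappa c₀ V) in
/-- The homogeneous components of the induced module with respect to the degree in the `x i`. -/
noncomputable def Induced.layer : ℕ → AddSubgroup (Induced n kappa c₀ V)
  | 0 => (gen).range
  | d + 1 => AddSubgroup.closure {m | ∃ i, ∃ w ∈ Induced.layer d, RCA.x F n kappa c₀ i • w = m}

local notation "layer" => Induced.layer n kappa c₀ V

theorem Induced.layer_induction {d : ℕ} {p : Induced n kappa c₀ V → Prop}
    (h : ∀ i, ∀ w ∈ layer d, p (RCA.x F n kappa c₀ i • w)) (h0 : p 0)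
    (hadd : ∀ v w, p v → p w → p (v + w)) (hneg : ∀ v, p v → p (-v))
    {m : Induced n kappa c₀ V} (hm : m ∈ layer (d + 1)) : p m := by
  rw [Induced.layer] at hm
  induction hm using AddSubgroup.closure_induction with
  | mem m hm => obtain ⟨i, w, hw, rfl⟩ := hm; exact h i w hw
  | zero => exact h0
  | add v w _ _ hv hw => exact hadd v w hv hw
  | neg v _ hv => exact hneg v hv

theorem Induced.x_smul_mem_layer {d : ℕ} (i : Fin n) {w : Induced n kappa c₀ V}
    (hw : w ∈ layer d) : RCA.x F n kappa c₀ i • w ∈ layer (d + 1) :=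
  AddSubgroup.subset_closure ⟨i, w, hw, rfl⟩

theorem Induced.t_smul_mem_layer {d : ℕ} (σ : Equiv.Perm (Fin n)) {w : Induced n kappa c₀ V}
    (hw : w ∈ layer d) : RCA.t F n kappa c₀ σ • w ∈ layer d := by
  induction d generalizing w with
  | zero =>
    obtain ⟨v, rfl⟩ := hw
    exact ⟨_, (Induced.t_smul_gen σ v).symm⟩
  | succ d ih =>
    refine Induced.layer_induction (p := fun w => RCA.t F n kappa c₀ σ • w ∈ layer (d + 1))
      (fun i w hw => ?_) ?_ (fun v w hv hw => ?_) (fun v hv => ?_) hw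
    · rw [← mul_smul, RCA.t_mul_x, mul_smul]
      exact Induced.x_smul_mem_layer _ (ih hw)
    · rw [smul_zero]; exact zero_mem _
    · rw [smul_add]; exact add_mem hv hw
    · rw [smul_neg]; exact neg_mem hv

theorem Induced.algebraMap_smul_mem_layer {d : ℕ} (a : F) {w : Induced n kappa c₀ V}
    (hw : w ∈ layer d) : algebraMap F (RCA F n kappa c₀) a • w ∈ layer d := by
  induction d generalizing w with
  | zero =>
    obtain ⟨v, rfl⟩ := hw
    exact ⟨_, (Induced.algebraMap_smul_gen a v).symm⟩
  | succ d ih =>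
    refine Induced.layer_induction (p := fun w => algebraMap F (RCA F n kappa c₀) a • w ∈ layer (d + 1))
      (fun i w hw => ?_) ?_ (fun v w hv hw => ?_) (fun v hv => ?_) hw
    · rw [← mul_smul, Algebra.commutes, mul_smul]
      exact Induced.x_smul_mem_layer _ (ih hw)
    · rw [smul_zero]; exact zero_mem _
    · rw [smul_add]; exact add_mem hv hw
    · rw [smul_neg]; exact neg_mem hv

theorem Induced.smul_mem_iSup_of_forall {h : RCA F n kappa c₀}
    (hl : ∀ d, ∀ w ∈ layer d, h • w ∈ ⨆ d, layer d) {m : Induced n kappa c₀ V}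
    (hm : m ∈ ⨆ d, layer d) : h • m ∈ ⨆ d, layer d := by
  induction hm using AddSubgroup.iSup_induction' with
  | hp d w hw => exact hl d w hw
  | h1 => rw [smul_zero]; exact zero_mem _
  | hadd v w _ _ hv hw => rw [smul_add]; exact add_mem hv hw

theorem Induced.y_smul_mem_iSup {d : ℕ} (i : Fin n) {w : Induced n kappa c₀ V}
    (hw : w ∈ layer d) : RCA.y F n kappa c₀ i • w ∈ ⨆ d, layer d := by
  have hle : ∀ d, layer d ≤ ⨆ d, layer d := le_iSup _
  induction d generalizing w with
  | zero =>
    obtain ⟨v, rfl⟩ := hw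
    rw [Induced.y_smul_gen]
    exact zero_mem _
  | succ d ih =>
    refine Induced.layer_induction (p := fun w => RCA.y F n kappa c₀ i • w ∈ ⨆ d, layer d)
      (fun j w hw => ?_) ?_ (fun v w hv hw => ?_) (fun v hv => ?_) hw
    · have hx : RCA.x F n kappa c₀ j • RCA.y F n kappa c₀ i • w ∈ ⨆ d, layer d :=
        Induced.smul_mem_iSup_of_forall
          (fun d w hw => hle (d + 1) (Induced.x_smul_mem_layer j hw)) (ih hw)
      by_cases hij : i = j
      · subst hij
        rw [← mul_smul, RCA.y_mul_x_self, sub_smul, add_smul, mul_smul, Algebra.smul_def, mul_smul,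
          Finset.sum_smul]
        refine sub_mem (add_mem hx (hle d (Induced.algebraMap_smul_mem_layer _ hw)))
          (hle d (Induced.algebraMap_smul_mem_layer _ (sum_mem fun j _ => ?_)))
        exact Induced.t_smul_mem_layer _ hw
      · rw [← mul_smul, RCA.y_mul_x_of_ne hij, add_smul, mul_smul, Algebra.smul_def, mul_smul]
        exact add_mem hx (hle d (Induced.algebraMap_smul_mem_layer _
          (Induced.t_smul_mem_layer _ hw)))
    · rw [smul_zero]; exact zero_mem _
    · rw [smul_add]; exact add_mem hv hw
    · rw [smul_neg]; exact neg_mem hv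

theorem Induced.smul_mem_iSup (h : RCA F n kappa c₀) {m : Induced n kappa c₀ V}
    (hm : m ∈ ⨆ d, layer d) : h • m ∈ ⨆ d, layer d := by
  have hle : ∀ d, layer d ≤ ⨆ d, layer d := le_iSup _
  obtain ⟨a, rfl⟩ := RingQuot.mkAlgHom_surjective F (Rel F n kappa c₀) h
  change RCA.mk F n kappa c₀ a • m ∈ _
  induction a using FreeAlgebra.induction generalizing m with
  | grade0 r =>
    rw [AlgHom.commutes]
    exact Induced.smul_mem_iSup_of_forall
      (fun d w hw => hle d (Induced.algebraMap_smul_mem_layer r hw)) hm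
  | grade1 g =>
    cases g with
    | x i =>
      exact Induced.smul_mem_iSup_of_forall (V := V) (h := RCA.x F n kappa c₀ i)
        (fun d w hw => hle (d + 1) (Induced.x_smul_mem_layer i hw)) hm
    | y i =>
      exact Induced.smul_mem_iSup_of_forall (V := V) (h := RCA.y F n kappa c₀ i)
        (fun d w hw => Induced.y_smul_mem_iSup i hw) hm
    | t σ =>
      exact Induced.smul_mem_iSup_of_forall (V := V) (h := RCA.t F n kappa c₀ σ)
        (fun d w hw => hle d (Induced.t_smul_mem_layer σ hw)) hm
  | mul a b ha hb => rw [map_mul, mul_smul]; exact ha (hb hm)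
  | add a b ha hb => rw [map_add, add_smul]; exact add_mem (ha hm) (hb hm)

theorem Induced.induction_on_gen {p : Induced n kappa c₀ V → Prop} (m : Induced n kappa c₀ V)
    (h : ∀ (a : RCA F n kappa c₀) (v : V), p (a • gen v)) (h0 : p 0)
    (hadd : ∀ v w, p v → p w → p (v + w)) : p m := by
  obtain ⟨b, rfl⟩ := Submodule.Quotient.mk_surjective _ m
  induction b using TensorProduct.induction_on with
  | zero => exact h0
  | tmul a v => have := h a v; rwa [Induced.smul_gen] at this
  | add a b ha hb => exact hadd _ _ ha hb

theorem Induced.mem_iSup_layer (m : Induced n kappa c₀ V) : m ∈ ⨆ d, layer d := by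
  refine Induced.induction_on_gen m (fun a v => ?_) (zero_mem _) fun _ _ => add_mem
  exact Induced.smul_mem_iSup a ((le_iSup layer 0) ⟨v, rfl⟩)

end Induced

/-! ### Propagation of the spectrum through the layers -/

section Spectrum

variable {F : Type*} [Field F] {n : ℕ} {kappa c₀ : F}
  {V : Type*} [AddCommGroup V] [Module F V] [Module (MonoidAlgebra F (Equiv.Perm (Fin (n + 1)))) V]
  [IsScalarTower F (MonoidAlgebra F (Equiv.Perm (Fin (n + 1)))) V]

/-- The joint spectrum on each homogeneous component comes from the previous one by rotating,
shifting one entry by `kappa`, and permuting. -/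
theorem Induced.exists_isSymmetric_annihilating_layer
    (φ : MvPolynomial (Fin (n + 1)) F →ₐ[F] RCA F (n + 1) kappa c₀)
    (hφ : ∀ i, φ (X i) = RCA.z F (n + 1) kappa c₀ i) (Good : (Fin (n + 1) → F) → Prop)
    (hbase : ∀ χ, ¬ Good χ → ∃ f : MvPolynomial (Fin (n + 1)) F, f.IsSymmetric ∧ eval χ f ≠ 0 ∧
      ∀ v, φ f • Induced.gen (n + 1) kappa c₀ V v = 0)
    (hstep : ∀ (χ : Fin (n + 1) → F) (σ : Equiv.Perm (Fin (n + 1))),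
      Good (fun i => χ (σ i) - if i = Fin.last n then kappa else 0) → Good χ)
    (d : ℕ) (χ : Fin (n + 1) → F) (hχ : ¬ Good χ) :
    ∃ f : MvPolynomial (Fin (n + 1)) F, f.IsSymmetric ∧ eval χ f ≠ 0 ∧
      ∀ m ∈ Induced.layer (n + 1) kappa c₀ V d, φ f • m = 0 := by
  classical
  induction d generalizing χ with
  | zero =>
    obtain ⟨f, hf, hf', hf''⟩ := hbase χ hχ
    refine ⟨f, hf, hf', ?_⟩
    rintro _ ⟨v, rfl⟩
    exact hf'' v
  | succ d ih =>
    let π := finRotate (n + 1)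
    let δ : Fin (n + 1) → F := fun i => if i = Fin.last n then kappa else 0
    -- Symmetry is dropped here because prime avoidance needs an ideal; a product over all renamings
    -- restores it.
    let I : Ideal (MvPolynomial (Fin (n + 1)) F) :=
      { carrier := {f | ∀ m ∈ Induced.layer (n + 1) kappa c₀ V d, φ f • m = 0}
        add_mem' := fun ha hb m hm => by rw [map_add, add_smul, ha m hm, hb m hm, add_zero]
        zero_mem' := fun m _ => by rw [map_zero, zero_smul]
        smul_mem' := fun a f hf m hm => by
          rw [smul_eq_mul, map_mul, mul_smul, hf m hm, smul_zero] }
    -- The values of `f` at these points are the values at `χ` of the factors in the product over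
    -- renamings.
    obtain ⟨f, hf, hf'⟩ := exists_forall_eval_ne_zero I
      (fun (σ : Equiv.Perm (Fin (n + 1))) i => χ (σ (π i)) - δ i) fun σ => by
        obtain ⟨f, -, h₁, h₂⟩ := ih (fun i => χ (σ (π i)) - δ i)
          fun h => hχ (hstep χ (π.trans σ) h)
        exact ⟨f, h₂, h₁⟩
    -- `ψ` describes the passage of a polynomial in the `z i` from the left to the right of the
    -- intertwiner, and `ψ'` undoes it.
    let ψ : MvPolynomial (Fin (n + 1)) F →ₐ[F] MvPolynomial (Fin (n + 1)) F :=
      aeval fun i => X (π.symm i) + C (δ (π.symm i))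
    let ψ' : MvPolynomial (Fin (n + 1)) F →ₐ[F] MvPolynomial (Fin (n + 1)) F :=
      aeval fun i => X (π i) - C (δ i)
    have hψ : ψ.comp ψ' = AlgHom.id F _ := by
      refine algHom_ext fun i => ?_
      have hC : ∀ a : F, ψ (C a) = C a := fun a => ψ.commutes a
      simp only [AlgHom.comp_apply, AlgHom.id_apply, ψ', aeval_X, map_sub, hC]
      simp [ψ]
    have hψ' : ψ (ψ' f) = f := by
      rw [← AlgHom.comp_apply, hψ, AlgHom.id_apply]
    have hΦ : ∀ i, φ (X i) * (RCA.x F (n + 1) kappa c₀ 0 * RCA.t F (n + 1) kappa c₀ π) =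
        RCA.x F (n + 1) kappa c₀ 0 * RCA.t F (n + 1) kappa c₀ π * φ (ψ (X i)) := by
      intro i
      have hC : ∀ a : F, φ (C a) = algebraMap F _ a := fun a => φ.commutes a
      simp only [ψ, aeval_X, map_add, hφ, hC]
      refine Fin.cases ?_ (fun i => ?_) i
      · have h0 : π.symm 0 = Fin.last n := by rw [Equiv.symm_apply_eq]; simp [π]
        simp only [h0, δ, if_true]
        exact RCA.z_zero_mul_intertwiner
      · have hi : π.symm i.succ = i.castSucc := by rw [Equiv.symm_apply_eq]; simp [π]
        simp only [hi, δ, i.castSucc_lt_last.ne, if_false, map_zero, add_zero]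
        exact RCA.z_succ_mul_intertwiner i
    have hsym := isSymmetric_prod_rename (ψ' f)
    -- Being symmetric, the product passes the `t w`. Its factor for `σ = 1` becomes `ψ (ψ' f) = f`
    -- beyond the intertwiner and kills the layer below.
    refine ⟨∏ σ : Equiv.Perm (Fin (n + 1)), rename σ (ψ' f), hsym, ?_, fun m hm => ?_⟩
    · rw [map_prod, Finset.prod_ne_zero_iff]
      intro σ _
      have heval : eval χ (rename σ (ψ' f)) = eval (fun i => χ (σ (π i)) - δ i) f := by
        have : ((aeval χ : MvPolynomial (Fin (n + 1)) F →ₐ[F] F).comp ((rename σ).comp ψ')) =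
            aeval (fun i => χ (σ (π i)) - δ i) := by
          refine algHom_ext fun i => ?_
          simp [ψ']
        simpa [aeval_eq_eval] using DFunLike.congr_fun this f
      rw [heval]
      exact hf' σ
    · refine Induced.layer_induction
        (p := fun m => φ (∏ σ : Equiv.Perm (Fin (n + 1)), rename σ (ψ' f)) • m = 0)
        (fun i w hw => ?_) (smul_zero _)
        (fun v w hv hw => by rw [smul_add, hv, hw, add_zero])
        (fun v hv => by rw [smul_neg, hv, neg_zero]) hm
      have hx : RCA.x F (n + 1) kappa c₀ i = RCA.t F (n + 1) kappa c₀ (Equiv.swap 0 i) *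
          (RCA.x F (n + 1) kappa c₀ 0 * RCA.t F (n + 1) kappa c₀ π) *
            RCA.t F (n + 1) kappa c₀ (π⁻¹ * Equiv.swap 0 i) := by
        rw [mul_assoc, mul_assoc, ← RCA.t_mul, mul_inv_cancel_left, ← mul_assoc, RCA.t_mul_x,
          mul_assoc, ← RCA.t_mul, Equiv.swap_mul_self, RCA.t_one, mul_one,
          Equiv.swap_apply_left]
      have hg : φ (∏ σ : Equiv.Perm (Fin (n + 1)), rename σ (ψ' f)) =
          φ (∏ σ ∈ (Finset.univ : Finset (Equiv.Perm (Fin (n + 1)))).erase 1, rename σ (ψ' f)) *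
            φ (ψ' f) := by
        rw [← map_mul, ← Finset.prod_erase_mul Finset.univ _ (Finset.mem_univ 1),
          Equiv.Perm.coe_one, rename_id_apply]
      rw [hx, ← mul_smul, ← mul_assoc, ← mul_assoc,
        ← (RCA.commute_t_of_isSymmetric φ hφ hsym _).eq, hg, mul_assoc (RCA.t _ _ _ _ _),
        mul_assoc (φ _), algHom_mul_eq_of_intertwine φ _ ψ hΦ, hψ', mul_smul, mul_smul, mul_smul,
        mul_smul, hf _ (Induced.t_smul_mem_layer _ hw), smul_zero, smul_zero, smul_zero]

/-- Every vector is a finite sum of homogeneous ones, and the product of their annihilators still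
does not vanish at `χ`. -/
theorem Induced.exists_isSymmetric_annihilating
    (φ : MvPolynomial (Fin (n + 1)) F →ₐ[F] RCA F (n + 1) kappa c₀)
    (hφ : ∀ i, φ (X i) = RCA.z F (n + 1) kappa c₀ i) (Good : (Fin (n + 1) → F) → Prop)
    (hbase : ∀ χ, ¬ Good χ → ∃ f : MvPolynomial (Fin (n + 1)) F, f.IsSymmetric ∧ eval χ f ≠ 0 ∧
      ∀ v, φ f • Induced.gen (n + 1) kappa c₀ V v = 0)
    (hstep : ∀ (χ : Fin (n + 1) → F) (σ : Equiv.Perm (Fin (n + 1))),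
      Good (fun i => χ (σ i) - if i = Fin.last n then kappa else 0) → Good χ)
    (m : Induced (n + 1) kappa c₀ V) (χ : Fin (n + 1) → F) (hχ : ¬ Good χ) :
    ∃ f : MvPolynomial (Fin (n + 1)) F, f.IsSymmetric ∧ eval χ f ≠ 0 ∧ φ f • m = 0 := by
  have hm := Induced.mem_iSup_layer m
  induction hm using AddSubgroup.iSup_induction' with
  | hp d w hw =>
    obtain ⟨f, h₁, h₂, h₃⟩ :=
      Induced.exists_isSymmetric_annihilating_layer φ hφ Good hbase hstep d χ hχ
    exact ⟨f, h₁, h₂, h₃ w hw⟩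
  | h1 => exact ⟨1, fun σ => by simp, by simp, smul_zero _⟩
  | hadd v w _ _ hv hw =>
    obtain ⟨f, h₁, h₂, h₃⟩ := hv
    obtain ⟨g, k₁, k₂, k₃⟩ := hw
    refine ⟨f * g, h₁.mul k₁, by rw [map_mul]; exact mul_ne_zero h₂ k₂, ?_⟩
    have e₁ : φ (f * g) • v = 0 := by rw [mul_comm, map_mul, mul_smul, h₃, smul_zero]
    have e₂ : φ (f * g) • w = 0 := by rw [map_mul, mul_smul, k₃, smul_zero]
    rw [smul_add, e₁, e₂, add_zero]

end Spectrum

/-! ### From composition factors to matchings of boxes -/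

section CompositionFactors

variable {F : Type*} [Field F] [CharZero F]

/-- If `L(mu)` is a composition factor of `M(lam)`, then the boxes of `mu` can be matched with those
of `lam` so that the differences of contents become natural numbers after multiplication by
`c₀`. -/
theorem exists_equiv_content_of_isCompositionFactor {n : ℕ} {c₀ : F} {lam mu : YoungDiagram}
    (hlam : lam.card = n + 1) (hmu : mu.card = n + 1)
    (h : IsCompositionFactor (RCA F (n + 1) 1 c₀) (SimpleHead (n + 1) 1 c₀ mu hmu)
      (StandardModule (n + 1) 1 c₀ lam hlam)) :
    ∃ e : mu.cells ≃ lam.cells, ∀ b, ∃ a : ℕ, (a : F) =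
      c₀ * ((((e b).1.2 : F) - (e b).1.1) - ((b.1.2 : F) - b.1.1)) := by
  obtain ⟨φ, hφ⟩ := exists_algHom_of_commute (F := F) (RCA.z F (n + 1) 1 c₀) RCA.commute_z
  obtain ⟨ψ, hψ⟩ := exists_algHom_of_commute (F := F)
    (fun i => algebraMap F (MonoidAlgebra F (Equiv.Perm (Fin (n + 1)))) 1 +
      (-c₀) • jucysMurphy F i) fun i j =>
        ((Algebra.commute_algebraMap_left _ _).add_left
          (((Algebra.commute_algebraMap_right _ _).add_right
            (((commute_jucysMurphy i j).smul_left _).smul_right _))))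
  obtain ⟨T, hT⟩ := exists_symmetric_smul_specht (F := F) hlam
  obtain ⟨U, hU⟩ := exists_symmetric_smul_specht (F := F) hmu
  replace hT := hT 1 (-c₀) ψ hψ
  replace hU := hU 1 (-c₀) ψ hψ
  -- The points allowed on `M(lam)`: the spectrum of its generators, reordered and raised by natural
  -- numbers.
  let Good : (Fin (n + 1) → F) → Prop := fun χ => ∃ (e : Fin (n + 1) ≃ lam.cells)
    (a : Fin (n + 1) → ℕ), ∀ i, χ i = 1 + a i + -c₀ * (((e i).1.2 : F) - (e i).1.1)
  have hgood : Good fun i => 1 + -c₀ * (((U i).1.2 : F) - (U i).1.1) := by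
    obtain ⟨hsimple, N, P, -, ⟨ι⟩⟩ := h
    by_contra hcon
    have hall : ∀ m : StandardModule (n + 1) 1 c₀ lam hlam, ∃ f : MvPolynomial (Fin (n + 1)) F,
        f.IsSymmetric ∧ eval (fun i => 1 + -c₀ * (((U i).1.2 : F) - (U i).1.1)) f ≠ 0 ∧
          φ f • m = 0 := by
      intro m
      refine Induced.exists_isSymmetric_annihilating φ hφ Good ?_ ?_ m _ hcon
      · intro χ hχ
        -- Either `χ` is a reordering of the spectrum of the generators, hence good with zero
        -- shifts, or some elementary symmetric polynomial tells them apart.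
        by_cases hall : ∀ d, eval χ (esymm (Fin (n + 1)) F d) =
            eval (fun i => 1 + -c₀ * (((T i).1.2 : F) - (T i).1.1)) (esymm (Fin (n + 1)) F d)
        · obtain ⟨σ, rfl⟩ := map_univ_eq_of_esymm_eq _ _ hall
          exact absurd ⟨σ.trans T, fun _ => 0, fun i => by simp⟩ hχ
        · obtain ⟨d, hd⟩ := not_forall.1 hall
          refine ⟨esymm (Fin (n + 1)) F d - C (eval (fun i => 1 + -c₀ *
            (((T i).1.2 : F) - (T i).1.1)) (esymm (Fin (n + 1)) F d)),
            (esymm_isSymmetric _ _ _).sub (IsSymmetric.C _), ?_, fun v => ?_⟩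
          · rw [map_sub, eval_C]; exact sub_ne_zero.2 hd
          · rw [Induced.algHom_smul_gen φ hφ ψ hψ,
              hT _ ((esymm_isSymmetric _ _ _).sub (IsSymmetric.C _)), map_sub, eval_C, sub_self,
              zero_smul, map_zero]
      · rintro χ σ ⟨e, a, hea⟩
        -- The entry that `σ` takes to the last place was lowered by `kappa = 1`, so its natural
        -- shift grows by `1`.
        refine ⟨σ.symm.trans e, fun i => a (σ.symm i) + if σ.symm i = Fin.last n then 1 else 0,
          fun i => ?_⟩
        have := hea (σ.symm i)
        beta_reduce at this
        rw [Equiv.apply_symm_apply, sub_eq_iff_eq_add] at this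
        rw [this, Equiv.trans_apply]
        push_cast
        ring
    -- The generators generate `M(mu)`, so they cannot all vanish in a nonzero quotient.
    have hne : ∃ v, (Submodule.Quotient.mk (Induced.gen (n + 1) 1 c₀ (Specht F mu hmu) v) :
        SimpleHead (n + 1) 1 c₀ mu hmu) ≠ 0 := by
      by_contra! hzero
      have hnt := hsimple.nontrivial
      obtain ⟨l, hl⟩ := exists_ne (0 : SimpleHead (n + 1) 1 c₀ mu hmu)
      obtain ⟨m, rfl⟩ := Submodule.Quotient.mk_surjective _ l
      refine hl ?_
      refine Induced.induction_on_gen (p := fun m => (Submodule.Quotient.mk m :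
        SimpleHead (n + 1) 1 c₀ mu hmu) = 0) m (fun a v => ?_) rfl fun v w hv hw => ?_
      · rw [Submodule.Quotient.mk_smul, hzero, smul_zero]
      · rw [Submodule.Quotient.mk_add, hv, hw, add_zero]
    obtain ⟨v, hv⟩ := hne
    obtain ⟨p, hp⟩ := Submodule.Quotient.mk_surjective _ (ι.symm (Submodule.Quotient.mk
      (Induced.gen (n + 1) 1 c₀ (Specht F mu hmu) v)))
    -- `f` kills the lift `p` but multiplies the image of the generator by a nonzero scalar, a
    -- contradiction.
    obtain ⟨f, hf, hf', hf''⟩ := hall p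
    have h₁ : φ f • p = 0 := Subtype.ext hf''
    have h₂ := congrArg (fun l => φ f • ι l) hp
    simp only [LinearEquiv.apply_symm_apply] at h₂
    rw [← map_smul, ← Submodule.Quotient.mk_smul, h₁, Submodule.Quotient.mk_zero, map_zero,
      ← Submodule.Quotient.mk_smul, Induced.algHom_smul_gen φ hφ ψ hψ, hU f hf,
      ← Induced.algebraMap_smul_gen, Submodule.Quotient.mk_smul] at h₂
    apply hv
    have h₃ := congrArg (fun l => algebraMap F (RCA F (n + 1) 1 c₀)
      (eval (fun i => 1 + -c₀ * (((U i).1.2 : F) - (U i).1.1)) f)⁻¹ • l) h₂.symm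
    simpa only [smul_zero, ← mul_smul, ← map_mul, inv_mul_cancel₀ hf', map_one, one_smul] using h₃
  obtain ⟨e, a, hea⟩ := hgood
  refine ⟨U.symm.trans e, fun b => ⟨a (U.symm b), ?_⟩⟩
  have := hea (U.symm b)
  beta_reduce at this
  rw [Equiv.apply_symm_apply] at this
  rw [Equiv.trans_apply]
  linear_combination -this

end CompositionFactors

/-! ### Contents, dominance and cores -/

section Combinatorics

/-- The content of a box. -/
def content (b : ℕ × ℕ) : ℤ := b.2 - b.1

theorem sum_rowLen_eq_card (nu : YoungDiagram) (j : ℕ) :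
    ∑ i ∈ Finset.range j, nu.rowLen i = (nu.cells.filter fun b => b.1 < j).card := by
  rw [Finset.card_eq_sum_card_fiberwise (f := Prod.fst) (t := Finset.range j)]
  · refine Finset.sum_congr rfl fun i hi => ?_
    rw [YoungDiagram.rowLen_eq_card, YoungDiagram.row, Finset.filter_filter]
    congr 1
    refine Finset.filter_congr fun b _ => ?_
    rw [Finset.mem_range] at hi
    constructor
    · rintro rfl; exact ⟨hi, rfl⟩
    · exact fun h => h.2
  · intro b hb
    simpa using (Finset.mem_filter.1 hb).2

/-- A matching of boxes that raises contents forces dominance. -/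
theorem dominanceLE_of_equiv {lam mu : YoungDiagram} (e : mu.cells ≃ lam.cells)
    (he : ∀ b, content b.1 ≤ content (e b).1) : DominanceLE mu lam := by
  refine ⟨by simpa using Fintype.card_congr e, fun j => ?_⟩
  -- With this threshold, all boxes of `lam` of content at least `c` lie above row `j`, and every
  -- position above row `j` with content below `c` that lies in `mu` also lies in `lam`. The
  -- matching compares the former boxes, inclusion the latter.
  set c : ℤ := lam.rowLen j - j with hc
  have hN : (mu.cells.filter fun b => c ≤ content b).card ≤
      (lam.cells.filter fun b => c ≤ content b).card := by
    refine Finset.card_le_card_of_injOn (fun b => if h : b ∈ mu.cells then (e ⟨b, h⟩).1 else b)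
      (fun b hb => ?_) fun b hb b' hb' h => ?_
    · have hb := Finset.mem_filter.1 hb
      beta_reduce
      rw [dif_pos hb.1]
      exact Finset.mem_filter.2 ⟨(e _).2, hb.2.trans (he ⟨b, hb.1⟩)⟩
    · have hb := (Finset.mem_filter.1 hb).1
      have hb' := (Finset.mem_filter.1 hb').1
      beta_reduce at h
      rw [dif_pos hb, dif_pos hb'] at h
      exact congrArg Subtype.val (e.injective (Subtype.ext h))
  have hlam : (lam.cells.filter fun b => c ≤ content b) ⊆
      (lam.cells.filter fun b => b.1 < j).filter fun b => c ≤ content b := by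
    intro b hb
    rw [Finset.mem_filter] at hb
    rw [Finset.mem_filter, Finset.mem_filter]
    refine ⟨⟨hb.1, ?_⟩, hb.2⟩
    by_contra hj
    have h₁ := lam.rowLen_anti j b.1 (not_lt.1 hj)
    have h₂ := YoungDiagram.mem_iff_lt_rowLen.1 ((YoungDiagram.mem_cells _).1 hb.1)
    have h₃ := hb.2
    rw [content] at h₃
    omega
  have hmu : ((mu.cells.filter fun b => b.1 < j).filter fun b => c ≤ content b) ⊆
      (mu.cells.filter fun b => c ≤ content b) := by
    intro b hb
    rw [Finset.mem_filter, Finset.mem_filter] at hb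
    exact Finset.mem_filter.2 ⟨hb.1.1, hb.2⟩
  have hlow : ((mu.cells.filter fun b => b.1 < j).filter fun b => ¬ c ≤ content b) ⊆
      ((lam.cells.filter fun b => b.1 < j).filter fun b => ¬ c ≤ content b) := by
    intro b hb
    rw [Finset.mem_filter, Finset.mem_filter] at hb ⊢
    refine ⟨⟨(YoungDiagram.mem_cells _).2 (YoungDiagram.mem_iff_lt_rowLen.2 ?_), hb.1.2⟩, hb.2⟩
    have h₁ := lam.rowLen_anti b.1 j hb.1.2.le
    have h₂ := hb.2
    have h₃ := hb.1.2
    rw [content] at h₂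
    omega
  rw [sum_rowLen_eq_card, sum_rowLen_eq_card,
    ← Finset.card_filter_add_card_filter_not (s := mu.cells.filter fun b => b.1 < j)
      (fun b => c ≤ content b),
    ← Finset.card_filter_add_card_filter_not (s := lam.cells.filter fun b => b.1 < j)
      (fun b => c ≤ content b)]
  exact add_le_add (((Finset.card_le_card hmu).trans hN).trans (Finset.card_le_card hlam))
    (Finset.card_le_card hlow)

/-! ### Residues of contents and rim hooks -/

/-- The number of boxes of a diagram whose content has residue `r`. -/
def residueCount (m : ℕ) (nu : YoungDiagram) (r : ZMod m) : ℕ :=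
  (nu.cells.filter fun b => (content b : ZMod m) = r).card

/-- A box of the rim is determined by its content. -/
theorem eq_of_content_eq {lam : YoungDiagram} {a b : ℕ × ℕ} (ha : a ∈ lam) (hb : b ∈ lam)
    (ha' : (a.1 + 1, a.2 + 1) ∉ lam) (hb' : (b.1 + 1, b.2 + 1) ∉ lam)
    (h : content a = content b) : a = b := by
  rw [content, content] at h
  rcases lt_trichotomy a.1 b.1 with hlt | heq | hlt
  · exact absurd (lam.up_left_mem (by omega) (by omega) hb) ha'
  · exact Prod.ext heq (by omega)
  · exact absurd (lam.up_left_mem (by omega) (by omega) ha) hb'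

/-- A discrete intermediate value theorem: contents of adjacent boxes differ by one. -/
theorem exists_content_eq_of_reflTransGen {H : Finset (ℕ × ℕ)} {a b : ℕ × ℕ} (ha : a ∈ H)
    (h : Relation.ReflTransGen (fun c d => d ∈ H ∧ Adjacent c d) a b) (d : ℤ)
    (hd : content a ≤ d ∧ d ≤ content b ∨ content b ≤ d ∧ d ≤ content a) :
    ∃ c ∈ H, content c = d := by
  induction h with
  | refl => exact ⟨a, ha, by omega⟩
  | @tail b c _ hbc ih =>
    by_cases hdc : content c = d
    · exact ⟨c, hbc.1, hdc⟩
    · refine ih ?_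
      have hadj := hbc.2
      simp only [Adjacent, content] at *
      omega

/-- The contents of a rim hook are distinct and fill an interval. Two congruent ones would force
more than `m` boxes, so its `m` boxes meet every residue exactly once. -/
theorem RemovesRimHook.residueCount_eq {m : ℕ} {lam nu : YoungDiagram}
    (h : RemovesRimHook m lam nu) (r : ZMod m) :
    residueCount m lam r = residueCount m nu r + 1 := by
  classical
  set H := lam.cells \ nu.cells with hH
  have hm : 0 < m := by
    rw [← h.card_eq]; exact Finset.card_pos.2 h.nonempty
  have : NeZero m := ⟨hm.ne'⟩
  have key : ∀ a ∈ H, ∀ b ∈ H, content a < content b →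
      (content a : ZMod m) ≠ (content b : ZMod m) := by
    intro a ha b hb hab heq
    have hdvd := (ZMod.intCast_eq_intCast_iff_dvd_sub _ _ _).1 heq
    have hge : (m : ℤ) ≤ content b - content a := Int.le_of_dvd (by omega) hdvd
    have hsub : Finset.Icc (content a) (content b) ⊆ H.image content := by
      intro d hd
      rw [Finset.mem_Icc] at hd
      rw [Finset.mem_image]
      exact exists_content_eq_of_reflTransGen ha (h.connected a ha b hb) d (Or.inl hd)
    have := (Finset.card_le_card hsub).trans Finset.card_image_le
    rw [Int.card_Icc, h.card_eq] at this
    omega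
  have hinj : Set.InjOn (fun b => (content b : ZMod m)) (H : Set (ℕ × ℕ)) := by
    intro a ha b hb hab
    rcases lt_trichotomy (content a) (content b) with hlt | heq | hlt
    · exact absurd hab (key a ha b hb hlt)
    · exact eq_of_content_eq (Finset.mem_sdiff.1 ha).1 (Finset.mem_sdiff.1 hb).1 (h.rim a ha)
        (h.rim b hb) heq
    · exact absurd hab.symm (key b hb a ha hlt)
  have himage : H.image (fun b => (content b : ZMod m)) = Finset.univ := by
    rw [← Finset.card_eq_iff_eq_univ, Finset.card_image_of_injOn hinj, h.card_eq, ZMod.card]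
  have hone : (H.filter fun b => (content b : ZMod m) = r).card = 1 := by
    have hr : r ∈ H.image (fun b => (content b : ZMod m)) := by rw [himage]; simp
    obtain ⟨a, ha, har⟩ := Finset.mem_image.1 hr
    rw [Finset.card_eq_one]
    refine ⟨a, ?_⟩
    ext b
    rw [Finset.mem_filter, Finset.mem_singleton]
    constructor
    · exact fun hb => hinj hb.1 ha (hb.2.trans har.symm)
    · rintro rfl; exact ⟨ha, har⟩
  have hunion : lam.cells = nu.cells ∪ H := by
    rw [hH, Finset.union_sdiff_of_subset (YoungDiagram.cells_subset_iff.2 h.le)]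
  rw [residueCount, residueCount, hunion, Finset.filter_union, Finset.card_union_of_disjoint, hone]
  exact Finset.disjoint_filter_filter Finset.disjoint_sdiff

theorem exists_residueCount_eq_of_reflTransGen {m : ℕ} {lam nu : YoungDiagram}
    (h : Relation.ReflTransGen (RemovesRimHook m) lam nu) :
    ∃ k : ℕ, ∀ r, residueCount m lam r = residueCount m nu r + k := by
  induction h with
  | refl => exact ⟨0, fun r => rfl⟩
  | tail _ hbc ih =>
    obtain ⟨k, hk⟩ := ih
    exact ⟨k + 1, fun r => by rw [hk, hbc.residueCount_eq]; ring⟩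

/-! ### The abacus and uniqueness of cores -/

/-- The positions of the beads of a diagram on an abacus; those of the empty diagram are the
nonpositive integers. -/
def beads (nu : YoungDiagram) : Set ℤ := Set.range fun i : ℕ => (nu.rowLen i : ℤ) - i

theorem strictAnti_beads (nu : YoungDiagram) :
    StrictAnti fun i : ℕ => (nu.rowLen i : ℤ) - i := by
  intro i j hij
  have := nu.rowLen_anti i j hij.le
  simp only
  omega

theorem eq_of_beads_eq {lam mu : YoungDiagram} (h : beads lam = beads mu) : lam = mu := by
  have h₁ : StrictMono fun i : ℕ => OrderDual.toDual ((lam.rowLen i : ℤ) - i) :=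
    fun i j hij => strictAnti_beads lam hij
  have h₂ : StrictMono fun i : ℕ => OrderDual.toDual ((mu.rowLen i : ℤ) - i) :=
    fun i j hij => strictAnti_beads mu hij
  have hfun := (h₁.range_inj h₂).1 h
  have hrow : ∀ i, lam.rowLen i = mu.rowLen i := by
    intro i
    have : (lam.rowLen i : ℤ) - i = (mu.rowLen i : ℤ) - i := congrFun hfun i
    omega
  refine YoungDiagram.ext (Finset.ext fun b => ?_)
  rw [YoungDiagram.mem_cells, YoungDiagram.mem_cells, ← Prod.mk.eta (p := b),
    YoungDiagram.mem_iff_lt_rowLen, YoungDiagram.mem_iff_lt_rowLen, hrow]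

/-- A bead with a gap `m` places below it gives a removable rim `m`-hook. -/
theorem exists_removesRimHook {m : ℕ} (hm : 0 < m) {lam : YoungDiagram} {c : ℤ}
    (hc : c ∈ beads lam) (hcm : c - m ∉ beads lam) : ∃ nu, RemovesRimHook m lam nu := by
  classical
  obtain ⟨i₀, hi₀⟩ := hc
  beta_reduce at hi₀
  have hgap : ∀ i : ℕ, (lam.rowLen i : ℤ) - i ≠ c - m := fun i hi => hcm ⟨i, hi⟩
  have hmem : ∀ {i j : ℕ}, (i, j) ∈ lam.cells ↔ j < lam.rowLen i := by
    intro i j; rw [YoungDiagram.mem_cells, YoungDiagram.mem_iff_lt_rowLen]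
  -- The hook is the stretch of the rim between the diagonals `c - m` and `c - 1`.
  let H := lam.cells.filter fun a => (a.1 + 1, a.2 + 1) ∉ lam.cells ∧ c - m ≤ content a ∧
    content a < c
  have hH : ∀ a, a ∈ H ↔ a ∈ lam.cells ∧ (a.1 + 1, a.2 + 1) ∉ lam.cells ∧ c - m ≤ content a ∧
    content a < c := fun a => Finset.mem_filter
  have hup : ∀ a ∈ H, ∀ b ∈ lam.cells, a ≤ b → b ∈ H := by
    rintro ⟨r, s⟩ ha ⟨r', s'⟩ hb ⟨hr, hs⟩
    rw [hH] at ha ⊢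
    obtain ⟨ha₁, ha₂, ha₃, ha₄⟩ := ha
    simp only [content, hmem, not_lt] at *
    have h₁ := lam.rowLen_anti (r + 1) (r' + 1) (by omega)
    refine ⟨hb, by omega, ?_, ?_⟩
    -- Leaving the stretch downwards would run along rows of equal length `s' + 1`, one of which has
    -- its bead at the gap `c - m`.
    · by_contra hcon
      have hrr : r < r' := by omega
      have hss : s' = s := by
        have := lam.rowLen_anti (r + 1) r' hrr
        omega
      subst hss
      obtain ⟨q, hq⟩ : ∃ q : ℕ, (q : ℤ) = s' - (c - m) := ⟨(s' - (c - m)).toNat, by omega⟩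
      have h₂ := lam.rowLen_anti (q + 1) r' (by omega)
      have h₃ := lam.rowLen_anti (r + 1) (q + 1) (by omega)
      refine hgap (q + 1) ?_
      push_cast
      omega
    -- Leaving it to the right puts row `r` above row `i₀`. Then the bead of row `i₀` is at most the
    -- content of the starting box, which is below `c`.
    · by_contra hcon
      have hrr : r = r' := by
        by_contra hne
        have := lam.rowLen_anti (r + 1) r' (by omega)
        omega
      subst hrr
      have hlt : r < i₀ := by
        by_contra hle
        have := lam.rowLen_anti i₀ r (by omega)
        omega
      have := lam.rowLen_anti (r + 1) i₀ hlt
      omega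
  let nu : YoungDiagram := ⟨lam.cells \ H, by
    intro b a hab hb
    simp only [Finset.coe_sdiff, Set.mem_sdiff, Finset.mem_coe] at hb ⊢
    exact ⟨lam.isLowerSet hab hb.1, fun ha => hb.2 (hup a ha b hb.1 hab)⟩⟩
  have hdiff : lam.cells \ nu.cells = H :=
    Finset.sdiff_sdiff_eq_self (Finset.filter_subset _ _)
  have hinj : ∀ a ∈ H, ∀ b ∈ H, content a = content b → a = b := by
    intro a ha b hb hab
    rw [hH] at ha hb
    exact eq_of_content_eq ha.1 hb.1 ha.2.1 hb.2.1 hab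
  have hsurj : ∀ d : ℤ, c - m ≤ d → d < c → ∃ a ∈ H, content a = d := by
    intro d hd₁ hd₂
    -- The first position of the diagonal is in `lam`: for `d ≥ 0` by the length of row `i₀`, and
    -- for `d < 0` because an empty row `m - c` would have its bead at the gap. The last box of the
    -- diagonal then lies on the rim.
    have hne : (lam.cells.filter fun a => content a = d).Nonempty := by
      refine ⟨((-d).toNat, d.toNat), Finset.mem_filter.2 ⟨hmem.2 ?_, ?_⟩⟩
      · rcases le_or_gt 0 d with h0 | h0
        · have := lam.rowLen_anti 0 i₀ (Nat.zero_le _)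
          have h0' : (-d).toNat = 0 := by omega
          rw [h0']
          omega
        · obtain ⟨q, hq⟩ : ∃ q : ℕ, (q : ℤ) = m - c := ⟨(m - c).toNat, by omega⟩
          have h₁ := hgap q
          have h₂ := lam.rowLen_anti (-d).toNat q (by omega)
          omega
      · simp only [content]; omega
    obtain ⟨a, ha, hmax⟩ := Finset.exists_max_image _ Prod.fst hne
    rw [Finset.mem_filter] at ha
    refine ⟨a, (hH a).2 ⟨ha.1, fun hcon => ?_, by omega, by omega⟩, ha.2⟩
    have := hmax (a.1 + 1, a.2 + 1) (Finset.mem_filter.2 ⟨hcon, by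
      rw [← ha.2]; simp only [content]; push_cast; ring⟩)
    simp at this
  have hcard : H.card = m := by
    have : H.card = (Finset.Ico (c - m) c).card := by
      refine Finset.card_bij (fun a _ => content a) (fun a ha => ?_) (fun a ha b hb => hinj a ha b hb)
        fun d hd => ?_
      · rw [Finset.mem_Ico]; exact ((hH a).1 ha).2.2
      · rw [Finset.mem_Ico] at hd
        obtain ⟨a, ha, had⟩ := hsurj d hd.1 hd.2
        exact ⟨a, ha, had⟩
    rw [this, Int.card_Ico]
    omega
  have hadj : ∀ a ∈ H, ∀ b ∈ H, content b = content a + 1 → Adjacent a b ∧ Adjacent b a := by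
    rintro ⟨r, s⟩ ha ⟨r', s'⟩ hb hab
    rw [hH] at ha hb
    obtain ⟨ha₁, ha₂, -⟩ := ha
    obtain ⟨hb₁, hb₂, -⟩ := hb
    simp only [content, hmem, not_lt, Adjacent] at *
    have h₁ : r' ≤ r := by
      by_contra hcon
      have := lam.rowLen_anti (r + 1) r' (by omega)
      omega
    have h₂ : r ≤ r' + 1 := by
      by_contra hcon
      have := lam.rowLen_anti (r' + 1) r (by omega)
      omega
    omega
  have hpath : ∀ k : ℕ, ∀ a ∈ H, ∀ b ∈ H, content b = content a + k →
      Relation.ReflTransGen (fun c d => d ∈ H ∧ Adjacent c d) a b ∧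
        Relation.ReflTransGen (fun c d => d ∈ H ∧ Adjacent c d) b a := by
    intro k
    induction k with
    | zero =>
      intro a ha b hb hab
      rw [hinj b hb a ha (by simpa using hab)]
      exact ⟨.refl, .refl⟩
    | succ k ih =>
      intro a ha b hb hab
      push_cast at hab
      have ha' := (hH a).1 ha
      have hb' := (hH b).1 hb
      obtain ⟨a', haH, hac⟩ := hsurj (content a + 1) (by omega) (by omega)
      obtain ⟨h₁, h₂⟩ := ih a' haH b hb (by omega)
      obtain ⟨h₃, h₄⟩ := hadj a ha a' haH hac
      exact ⟨.head ⟨haH, h₃⟩ h₁, .tail h₂ ⟨ha, h₄⟩⟩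
  refine ⟨nu, ⟨YoungDiagram.cells_subset_iff.1 Finset.sdiff_subset, ?_, ?_, ?_, ?_⟩⟩
  · rw [hdiff, ← Finset.card_pos, hcard]; exact hm
  · rw [hdiff, hcard]
  · rw [hdiff]; exact fun a ha => ((hH a).1 ha).2.1
  · rw [hdiff]
    intro a ha b hb
    rcases le_total (content a) (content b) with h | h
    · exact (hpath (content b - content a).toNat a ha b hb (by omega)).1
    · exact (hpath (content a - content b).toNat b hb a ha (by omega)).2

/-- The number of boxes on a diagonal. -/
def diagonalCount (nu : YoungDiagram) (c : ℤ) : ℕ := (nu.cells.filter fun b => content b = c).card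

open Classical in
/-- Consecutive diagonals differ by whether there is a bead between them. -/
theorem diagonalCount_sub (nu : YoungDiagram) (c : ℤ) :
    (diagonalCount nu (c - 1) : ℤ) + (if c ≤ 0 then 1 else 0) =
      diagonalCount nu c + if c ∈ beads nu then 1 else 0 := by
  -- Large enough to include every nonempty row and the rows `c.natAbs` and above it.
  set K := nu.colLen 0 + c.natAbs + 1
  have hK : ∀ i, 0 < nu.rowLen i → i < K := by
    intro i hi
    have := YoungDiagram.mem_iff_lt_colLen.1 (YoungDiagram.mem_iff_lt_rowLen.2 hi)
    omega
  have hdiag : ∀ d : ℤ, diagonalCount nu d =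
      ((Finset.range K).filter fun i : ℕ => -d ≤ i ∧ i + d < nu.rowLen i).card := by
    intro d
    refine Finset.card_bij (fun b _ => b.1) (fun b hb => ?_) (fun a ha b hb hab => ?_) fun i hi => ?_
    · rw [Finset.mem_filter, YoungDiagram.mem_cells, ← Prod.mk.eta (p := b),
        YoungDiagram.mem_iff_lt_rowLen, content] at hb
      rw [Finset.mem_filter, Finset.mem_range]
      simp only at hb ⊢
      exact ⟨hK _ (by omega), by omega, by omega⟩
    · have ha := (Finset.mem_filter.1 ha).2
      have hb := (Finset.mem_filter.1 hb).2
      rw [content] at ha hb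
      exact Prod.ext hab (by omega)
    · rw [Finset.mem_filter] at hi
      refine ⟨(i, (i + d).toNat), Finset.mem_filter.2 ⟨?_, ?_⟩, rfl⟩
      · rw [YoungDiagram.mem_cells, YoungDiagram.mem_iff_lt_rowLen]; omega
      · rw [content]; simp only; omega
  -- `A` is split in two ways. Equality in `i + c ≤ nu.rowLen i` means a bead at `c`; equality in
  -- `-c ≤ i` is possible exactly when `c ≤ 0`.
  set A := (Finset.range K).filter fun i : ℕ => -c ≤ i ∧ i + c ≤ nu.rowLen i with hA
  have h₁ : A.card = diagonalCount nu c + if c ∈ beads nu then 1 else 0 := by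
    rw [hdiag, ← Finset.card_filter_add_card_filter_not (s := A)
      (fun i : ℕ => (i : ℤ) + c < nu.rowLen i)]
    congr 1
    · rw [hA, Finset.filter_filter]
      congr 1
      refine Finset.filter_congr fun i _ => ?_
      omega
    · split_ifs with hc
      · obtain ⟨i, hi⟩ := hc
        beta_reduce at hi
        rw [Finset.card_eq_one]
        refine ⟨i, ?_⟩
        ext j
        rw [Finset.mem_filter, hA, Finset.mem_filter, Finset.mem_range, Finset.mem_singleton]
        constructor
        · intro hj
          refine (strictAnti_beads nu).injective ?_
          omega
        · rintro rfl
          refine ⟨⟨?_, by omega, by omega⟩, by omega⟩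
          rcases Nat.eq_zero_or_pos (nu.rowLen j) with h0 | h0
          · omega
          · exact hK j h0
      · rw [Finset.card_eq_zero, Finset.eq_empty_iff_forall_notMem]
        intro i hi
        rw [Finset.mem_filter, hA, Finset.mem_filter] at hi
        exact hc ⟨i, by beta_reduce; omega⟩
  have h₂ : A.card = diagonalCount nu (c - 1) + if c ≤ 0 then 1 else 0 := by
    rw [hdiag, ← Finset.card_filter_add_card_filter_not (s := A) (fun i : ℕ => -c < (i : ℤ))]
    congr 1
    · rw [hA, Finset.filter_filter]
      congr 1
      refine Finset.filter_congr fun i _ => ?_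
      omega
    · split_ifs with hc
      · rw [Finset.card_eq_one]
        refine ⟨(-c).toNat, ?_⟩
        ext j
        rw [Finset.mem_filter, hA, Finset.mem_filter, Finset.mem_range, Finset.mem_singleton]
        constructor
        · intro hj; omega
        · rintro rfl; omega
      · rw [Finset.card_eq_zero, Finset.eq_empty_iff_forall_notMem]
        intro i hi
        rw [Finset.mem_filter, hA, Finset.mem_filter] at hi
        omega
  have := h₁.symm.trans h₂
  split_ifs at this ⊢ <;> omega

theorem sum_diagonalCount (m : ℕ) (nu : YoungDiagram) (r : ZMod m) (S : Finset ℤ)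
    (hS : ∀ b ∈ nu.cells, content b ∈ S) :
    ∑ c ∈ S.filter (fun c : ℤ => (c : ZMod m) = r), diagonalCount nu c = residueCount m nu r := by
  rw [residueCount, Finset.card_eq_sum_card_fiberwise (f := content)
    (t := S.filter fun c : ℤ => (c : ZMod m) = r)]
  · refine Finset.sum_congr rfl fun c hc => ?_
    rw [diagonalCount, Finset.filter_filter]
    congr 1
    refine Finset.filter_congr fun b _ => ?_
    rw [Finset.mem_filter] at hc
    constructor
    · rintro rfl; exact ⟨hc.2, rfl⟩
    · exact fun h => h.2
  · intro b hb
    have hb := Finset.mem_filter.1 hb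
    exact Finset.mem_filter.2 ⟨hS b hb.1, hb.2⟩

open Classical in
/-- The number of beads on a runner, in a large interval, is determined by residue counts. -/
theorem card_beads (m : ℕ) (nu : YoungDiagram) (r : ZMod m) (N : ℤ)
    (hN : ∀ b ∈ nu.cells, -N < content b ∧ content b < N) :
    (residueCount m nu (r - 1) : ℤ) +
        (((Finset.Ioc (-N) N).filter fun c : ℤ => (c : ZMod m) = r).filter (· ≤ 0)).card =
      residueCount m nu r +
        (((Finset.Ioc (-N) N).filter fun c : ℤ => (c : ZMod m) = r).filter (· ∈ beads nu)).card := by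
  set S := (Finset.Ioc (-N) N).filter fun c : ℤ => (c : ZMod m) = r
  have h₁ : residueCount m nu r = ∑ c ∈ S, diagonalCount nu c :=
    (sum_diagonalCount m nu r _ fun b hb => by
      have := hN b hb; rw [Finset.mem_Ioc]; omega).symm
  have h₂ : residueCount m nu (r - 1) = ∑ c ∈ S, diagonalCount nu (c - 1) := by
    rw [← sum_diagonalCount m nu (r - 1) (Finset.Ioc (-N - 1) (N - 1)) fun b hb => by
      have := hN b hb; rw [Finset.mem_Ioc]; omega]
    refine Finset.sum_equiv (Equiv.addRight 1) (fun c => ?_) fun c _ => by simp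
    simp only [S, Finset.mem_filter, Finset.mem_Ioc, Equiv.coe_addRight, Int.cast_add,
      Int.cast_one, eq_sub_iff_add_eq]
    refine and_congr_left fun _ => ?_
    omega
  rw [h₁, h₂, ← Finset.sum_boole, ← Finset.sum_boole, Nat.cast_sum, Nat.cast_sum,
    ← Finset.sum_add_distrib, ← Finset.sum_add_distrib]
  exact Finset.sum_congr rfl fun c _ => diagonalCount_sub nu c

/-- Without removable hooks, the beads on each runner are pushed down as far as possible, so their
number in a large window determines them. -/
theorem eq_of_residueCount {m : ℕ} (hm : 0 < m) {lam mu : YoungDiagram}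
    (hlam : ∀ nu, ¬ RemovesRimHook m lam nu) (hmu : ∀ nu, ¬ RemovesRimHook m mu nu) (k l : ℕ)
    (h : ∀ r, residueCount m lam r + k = residueCount m mu r + l) : lam = mu := by
  classical
  have hdown : ∀ nu : YoungDiagram, (∀ rho, ¬ RemovesRimHook m nu rho) →
      ∀ c c' : ℤ, c ∈ beads nu → c' ≤ c → (c : ZMod m) = c' → c' ∈ beads nu := by
    intro nu hnu c c' hc hle heq
    obtain ⟨q, hq⟩ := (ZMod.intCast_eq_intCast_iff_dvd_sub _ _ _).1 heq.symm
    have hq0 : 0 ≤ q := by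
      by_contra hneg
      nlinarith
    obtain ⟨q, rfl⟩ := Int.eq_ofNat_of_zero_le hq0
    have hstep : ∀ j : ℕ, c - m * j ∈ beads nu := by
      intro j
      induction j with
      | zero => simpa using hc
      | succ j ih =>
        by_contra hcon
        have e : c - m * ((j + 1 : ℕ) : ℤ) = c - m * j - m := by push_cast; ring
        rw [e] at hcon
        obtain ⟨rho, hrho⟩ := exists_removesRimHook hm ih hcon
        exact hnu rho hrho
    have := hstep q
    rwa [show c - m * (q : ℤ) = c' by linarith] at this
  refine eq_of_beads_eq (Set.ext fun c₁ => ?_)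
  obtain ⟨N, hN⟩ : ∃ N : ℤ, (∀ b ∈ lam.cells ∪ mu.cells, -N < content b ∧ content b < N) ∧
      -N < c₁ ∧ c₁ < N := by
    refine ⟨∑ b ∈ lam.cells ∪ mu.cells, |content b| + |c₁| + 1, fun b hb => ?_, ?_⟩
    · have := Finset.single_le_sum (f := fun b => |content b|) (fun b _ => abs_nonneg _) hb
      have h₁ := abs_nonneg c₁
      have h₂ := neg_abs_le (content b)
      have h₃ := le_abs_self (content b)
      constructor <;> linarith
    · have := Finset.sum_nonneg (s := lam.cells ∪ mu.cells) (f := fun b => |content b|)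
        fun b _ => abs_nonneg _
      have h₂ := neg_abs_le c₁
      have h₃ := le_abs_self c₁
      constructor <;> linarith
  set S := (Finset.Ioc (-N) N).filter fun c : ℤ => (c : ZMod m) = (c₁ : ZMod m) with hS
  -- Bead numbers depend only on the difference of two residue counts, so `k` and `l` cancel.
  have hcard : (S.filter (· ∈ beads lam)).card = (S.filter (· ∈ beads mu)).card := by
    have e₁ := card_beads m lam c₁ N fun b hb => hN.1 b (Finset.mem_union_left _ hb)
    have e₂ := card_beads m mu c₁ N fun b hb => hN.1 b (Finset.mem_union_right _ hb)
    rw [← hS] at e₁ e₂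
    have e₃ := h c₁
    have e₄ := h (c₁ - 1)
    omega
  have hres : ∀ c ∈ S, ∀ c' ∈ S, (c : ZMod m) = c' := fun c hc c' hc' =>
    (Finset.mem_filter.1 hc).2.trans (Finset.mem_filter.1 hc').2.symm
  have heq : S.filter (· ∈ beads lam) = S.filter (· ∈ beads mu) := by
    -- Sets closed downwards on one runner are nested, so equal size makes them equal.
    by_cases hsub : S.filter (· ∈ beads lam) ⊆ S.filter (· ∈ beads mu)
    · exact Finset.eq_of_subset_of_card_le hsub hcard.ge
    · obtain ⟨c, hc, hc'⟩ := Finset.not_subset.1 hsub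
      rw [Finset.mem_filter] at hc hc'
      refine (Finset.eq_of_subset_of_card_le (fun d hd => ?_) hcard.le).symm
      rw [Finset.mem_filter] at hd ⊢
      refine ⟨hd.1, ?_⟩
      rcases le_total d c with hdc | hdc
      · exact hdown lam hlam c d hc.2 hdc (hres c hc.1 d hd.1)
      · exact absurd ⟨hc.1, hdown mu hmu d c hd.2 hdc (hres d hd.1 c hc.1)⟩ hc'
  have hmem : c₁ ∈ S := Finset.mem_filter.2 ⟨Finset.mem_Ioc.2 ⟨hN.2.1, hN.2.2.le⟩, rfl⟩
  have := Finset.ext_iff.1 heq c₁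
  simpa only [Finset.mem_filter, hmem, true_and] using this

/-- Each removal lowers all residue counts by one, so whichever hooks were removed, the counts of
the two cores differ by a constant. -/
theorem core_eq_of_residueCount {m : ℕ} (hm : 0 < m) {lam mu : YoungDiagram}
    (h : ∀ r, residueCount m lam r = residueCount m mu r) : core m lam = core m mu := by
  obtain ⟨h₁, h₂⟩ := Classical.choose_spec (exists_isCoreOf m lam)
  obtain ⟨h₃, h₄⟩ := Classical.choose_spec (exists_isCoreOf m mu)
  obtain ⟨k, hk⟩ := exists_residueCount_eq_of_reflTransGen h₁
  obtain ⟨l, hl⟩ := exists_residueCount_eq_of_reflTransGen h₃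
  exact eq_of_residueCount hm h₂ h₄ k l fun r =>
    (hk r).symm.trans ((h r).trans (hl r))

theorem core_eq_of_equiv {m : ℕ} (hm : 0 < m) {lam mu : YoungDiagram} (e : mu.cells ≃ lam.cells)
    (he : ∀ b, (m : ℤ) ∣ content (e b).1 - content b.1) : core m mu = core m lam := by
  refine core_eq_of_residueCount hm fun r => ?_
  have hres : ∀ b, (content b.1 : ZMod m) = content (e b).1 := fun b =>
    (ZMod.intCast_eq_intCast_iff_dvd_sub _ _ _).2 (he b)
  refine Finset.card_bij (fun b hb => (e ⟨b, (Finset.mem_filter.1 hb).1⟩).1) (fun b hb => ?_)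
    (fun a ha b hb hab => ?_) fun b hb => ?_
  · rw [Finset.mem_filter]
    exact ⟨(e _).2, by rw [← hres]; exact (Finset.mem_filter.1 hb).2⟩
  · exact congrArg Subtype.val (e.injective (Subtype.ext hab))
  · rw [Finset.mem_filter] at hb
    refine ⟨(e.symm ⟨b, hb.1⟩).1, Finset.mem_filter.2 ⟨(e.symm _).2, ?_⟩, by simp⟩
    rw [hres, Equiv.apply_symm_apply]
    exact hb.2

end Combinatorics

end Cherednik

theorem mainTheorem8 {F : Type*} [Field F] [Algebra ℂ F]
    (n k m : ℕ) (hk : 0 < k) (hm : 0 < m) (hkm : Nat.Coprime k m)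
    (lam mu : YoungDiagram) (hlam : lam.card = n) (hmu : mu.card = n)
    (h : Cherednik.IsCompositionFactor (Cherednik.RCA F n 1 ((k : F) / (m : F)))
      (Cherednik.SimpleHead n (1 : F) ((k : F) / (m : F)) mu hmu)
      (Cherednik.StandardModule n (1 : F) ((k : F) / (m : F)) lam hlam)) :
    Cherednik.DominanceLE mu lam ∧ Cherednik.core m mu = Cherednik.core m lam := by
  have : CharZero F := charZero_of_injective_algebraMap (algebraMap ℂ F).injective
  cases n with
  -- The intertwiner needs an index `0`; here the empty diagram is the only one.
  | zero =>
    have h0 : ∀ nu : YoungDiagram, nu.card = 0 → nu = ⊥ := fun nu hnu =>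
      YoungDiagram.ext (Finset.card_eq_zero.1 hnu)
    rw [h0 lam hlam, h0 mu hmu]
    exact ⟨⟨rfl, fun j => le_rfl⟩, rfl⟩
  | succ n =>
    obtain ⟨e, he⟩ := Cherednik.exists_equiv_content_of_isCompositionFactor hlam hmu h
    -- Characteristic zero allows the identity to be read in the integers once the denominator is
    -- cleared.
    have key : ∀ b, ∃ a : ℕ, (a : ℤ) * m =
        k * (Cherednik.content (e b).1 - Cherednik.content b.1) := by
      intro b
      obtain ⟨a, ha⟩ := he b
      refine ⟨a, ?_⟩
      have hmF : (m : F) ≠ 0 := Nat.cast_ne_zero.2 hm.ne'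
      rw [div_mul_eq_mul_div, eq_div_iff hmF] at ha
      rw [Cherednik.content, Cherednik.content]
      exact_mod_cast (Int.cast_injective (α := F) (by push_cast; exact ha))
    refine ⟨Cherednik.dominanceLE_of_equiv e fun b => ?_,
      Cherednik.core_eq_of_equiv hm e fun b => ?_⟩
    · obtain ⟨a, ha⟩ := key b
      have h₁ : 0 ≤ (k : ℤ) * (Cherednik.content (e b).1 - Cherednik.content b.1) := by
        rw [← ha]; positivity
      exact sub_nonneg.1 (nonneg_of_mul_nonneg_right h₁ (by exact_mod_cast hk))
    · obtain ⟨a, ha⟩ := key b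
      have hcop : IsCoprime (m : ℤ) (k : ℤ) := Nat.isCoprime_iff_coprime.2 hkm.symm
      exact hcop.dvd_of_dvd_mul_left ⟨a, by rw [← ha, mul_comm]⟩
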